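/- Let $\mathbb{K}$ be an arbitrary field, let $k \ge 2$ be an integer, and let $c_k = k/(k-1)^{(k-1)/k}$. For tensors $T \in \mathbb{K}^{n_1}\otimes\cdots\otimes\mathbb{K}^{n_k}$ and $S \in \mathbb{K}^{m_1}\otimes\cdots\otimes\mathbb{K}^{m_k}$, say that $T$ restricts to $S$ if there are linear maps $\pi_i : \mathbb{K}^{n_i}\to\mathbb{K}^{m_i}$ with $(\pi_1\otimes\cdots\otimes\pi_k)T = S$. Let $\mathsf{I}_{k,r} = \sum_{j=1}^r e_j\otimes\cdots\otimes e_j \in (\mathbb{K}^r)^{\otimes k}$ be the unit tensor. A function $f$ from the set of all tensors of order $k$ over $\mathbb{K}$ (of all dimensions) to $\mathbb{R}_{\ge 0}$ is a normalized monotone if $f(S)\le f(T)$ whenever $T$ restricts to $S$, and $f(\mathsf{I}_{k,r}) = r$ for all $r\in\mathbb{N}$. The flattenings of $T$ are the matrices $T_I \in (\bigotimes_{i\in I}\mathbb{K}^{n_i})\otimes(\bigotimes_{j\notin I}\mathbb{K}^{n_j})$ for $\emptyset\ne I\subsetneq\{1,\dots,k\}$. Let $T^{\boxtimes N}\in \mathbb{K}^{n_1^N}\otimes\cdots\otimes\mathbb{K}^{n_k^N}$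 denote the $N$-th Kronecker power of $T$. We write $f(T^{\boxtimes N})\ge c_k^{N-o(N)}$ for all $N$ if there is a sequence of real numbers $\epsilon_N$ with $\epsilon_N/N\to 0$ and $f(T^{\boxtimes N})\ge c_k^{N-\epsilon_N}$ for all $N$. Let $f$ be any normalized monotone. (1) For every nonzero $T \in \mathbb{K}^{n_1}\otimes\cdots\otimes\mathbb{K}^{n_k}$, if no flattening of $T$ has rank one, then $f(T^{\boxtimes N})\ge c_k^{N-o(N)}$ for all $N$. (2) If moreover $f(S)\le \operatorname{rk}(S_I)$ for every tensor $S$ of order $k$ over $\mathbb{K}$ and every $\emptyset\ne I\subsetneq\{1,\dots,k\}$, then for every nonzero $T \in \mathbb{K}^{n_1}\otimes\cdots\otimes\mathbb{K}^{n_k}$ exactly one of the following is true: (a) $f(T^{\boxtimes N}) = 1$ for all $N$; (b) $f(T^{\boxtimes N})\ge c_k^{N-o(N)}$ for all $N$. -/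

import Mathlib

namespace TensorGap

open scoped NNReal

/-- `k`-tensors in `K^{n 0} ⊗ ⋯ ⊗ K^{n (k-1)}`, given by their arrays of coefficients in the
standard basis. -/
abbrev KTensor (K : Type*) {k : ℕ} (n : Fin k → ℕ) : Type _ :=
  ((i : Fin k) → Fin (n i)) → K

/-- The image of `T` under `π₁ ⊗ ⋯ ⊗ π_k`, where the linear map `π i : K^{n i} → K^{m i}` is given
by its matrix in the standard bases. -/
def applyMaps {K : Type*} [Field K] {k : ℕ} {n m : Fin k → ℕ}
    (π : (i : Fin k) → Matrix (Fin (m i)) (Fin (n i)) K) (T : KTensor K n) : KTensor K m :=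
  fun b => ∑ a : (i : Fin k) → Fin (n i), (∏ i, π i (b i) (a i)) * T a

/-- `T ≥ S`: the tensor `T` restricts to `S`. -/
def RestrictsTo {K : Type*} [Field K] {k : ℕ} {n m : Fin k → ℕ}
    (T : KTensor K n) (S : KTensor K m) : Prop :=
  ∃ π : (i : Fin k) → Matrix (Fin (m i)) (Fin (n i)) K, applyMaps π T = S

/-- The unit tensor `I_{k,r} = ∑_{j<r} e_j ⊗ ⋯ ⊗ e_j` in `K^r ⊗ ⋯ ⊗ K^r`. -/
def unitTensor (K : Type*) [Field K] (k r : ℕ) : KTensor K (fun _ : Fin k => r) :=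
  ∑ j : Fin r, fun a => ∏ i : Fin k, (Pi.single j 1 : Fin r → K) (a i)

/-- The Kronecker product `T ⊠ S`, with `Fin (n i * m i)` identified with
`Fin (n i) × Fin (m i)`. -/
def kron {K : Type*} [Field K] {k : ℕ} {n m : Fin k → ℕ}
    (T : KTensor K n) (S : KTensor K m) : KTensor K (fun i => n i * m i) :=
  fun a => T (fun i => (finProdFinEquiv.symm (a i)).1) *
    S (fun i => (finProdFinEquiv.symm (a i)).2)

/-- The Kronecker power `T^{⊠N}`; the `0`-th power is the `1 × ⋯ × 1` tensor with entry `1`. -/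
def kronPow {K : Type*} [Field K] {k : ℕ} {n : Fin k → ℕ} (T : KTensor K n) :
    (N : ℕ) → KTensor K (fun i => n i ^ N)
  | 0 => fun _ => 1
  | N + 1 => kron (kronPow T N) T

/-- The flattening `T_I` as a matrix, with rows indexed by the standard basis of
`⨂_{i ∈ I} K^{n i}` and columns by the standard basis of `⨂_{i ∉ I} K^{n i}`. -/
def flattening {K : Type*} [Field K] {k : ℕ} {n : Fin k → ℕ} (T : KTensor K n)
    (I : Finset (Fin k)) :
    Matrix ((i : {i : Fin k // i ∈ I}) → Fin (n i)) ((i : {i : Fin k // i ∉ I}) → Fin (n i)) K :=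
  Matrix.of fun a b => T fun i => if h : i ∈ I then a ⟨i, h⟩ else b ⟨i, h⟩

/-- `I` splits the `k` tensor factors into two nonempty groups. -/
def IsSplitting {k : ℕ} (I : Finset (Fin k)) : Prop :=
  I.Nonempty ∧ I ≠ Finset.univ

/-- Some flattening of `T` (along a splitting into two nonempty groups) has rank one. -/
def HasRankOneFlattening {K : Type*} [Field K] {k : ℕ} {n : Fin k → ℕ}
    (T : KTensor K n) : Prop :=
  ∃ I : Finset (Fin k), IsSplitting I ∧ (flattening T I).rank = 1

/-- A nonnegative real parameter `f` of the `k`-tensors over `K` of all dimensions is a normalized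
monotone if it is monotone under restriction and takes the value `r` on `I_{k,r}`. -/
structure IsNormalizedMonotone {K : Type*} [Field K] {k : ℕ}
    (f : (n : Fin k → ℕ) → KTensor K n → ℝ≥0) : Prop where
  mono : ∀ (n m : Fin k → ℕ) (T : KTensor K n) (S : KTensor K m),
    RestrictsTo T S → f m S ≤ f n T
  unit : ∀ r : ℕ, f (fun _ => r) (unitTensor K k r) = r

/-- `f` is bounded from above by the ranks of all flattenings. -/
def BoundedByFlatteningRanks {K : Type*} [Field K] {k : ℕ}
    (f : (n : Fin k → ℕ) → KTensor K n → ℝ≥0) : Prop :=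
  ∀ (n : Fin k → ℕ) (T : KTensor K n) (I : Finset (Fin k)), IsSplitting I →
    f n T ≤ ((flattening T I).rank : ℝ≥0)

/-- `c_k = k / (k-1)^{(k-1)/k}`. -/
noncomputable def gapConst (k : ℕ) : ℝ :=
  (k : ℝ) / ((k : ℝ) - 1) ^ (((k : ℝ) - 1) / (k : ℝ))

/-- `u N ≥ c^{N - o(N)}` for all `N`. -/
def GrowsAtLeast (u : ℕ → ℝ) (c : ℝ) : Prop :=
  ∃ e : ℕ → ℝ, e =o[Filter.atTop] (fun N : ℕ => (N : ℝ)) ∧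
    ∀ N : ℕ, c ^ ((N : ℝ) - e N) ≤ u N

end TensorGap

namespace TensorGap

open scoped NNReal

/-! ### Functions that are polynomial along lines -/

/-! Let `F` be the multilinear form of `T`. Two slots are separated when, with all other slots
fixed, every 2×2 minor of `F` in these two slots vanishes. Over an infinite field non-separation of
distinct slots is transitive (`sep_trans`), and a class is separated as a group from its complement
(`exists_sep_compl`), which means that a flattening has rank one. So without rank-one flattenings no
two slots are separated, over the algebraic closure (`not_sep_extend`) or over `K` (`not_sep`).

Non-separation is used twice. Over a finite extension there are `x`, `y` with `F(x) = 0` such that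
replacing any single `x i` by `y i` makes `F` nonzero: `T` looks like a W-tensor plus terms with
more `y`s. In a power with `k * m` copies, let an ordered partition of the copies into `k` blocks of
size `m` give, in slot `i`, the product vector with `y i` on block `i` and `x i` elsewhere.
Evaluated at blocks taken from `k` partitions, the form can be nonzero only if these blocks cover
the copies, hence partition them. If a family of partitions allows this only when all `k` are equal
(`IsLocalUSP`), a unit tensor of the size of the family results (`diag_of_isLocalUSP`). Over `K`
itself, some power of `T` restricts to the unit tensor of size two (`diag_two`); boundedly many more
copies then pay for the descent from the extension (`exists_diag_add`).

It remains to find such families of size `((k * m).choose m) ^ (1 - o(1))`; the rate is `c_k`,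
because the `m`-th term of `(1 + (k - 1)) ^ (k * m)` is the largest. Hash the blocks by a random
linear map into an auxiliary finite field, unrelated to `K`, and keep the partitions whose first `k
- 1` shifted hashes coincide and lie in a Behrend-type set `B`. The hash of the last block is then
tied to the common value, so the mean property of `B` makes a partition glued from blocks of
survivors a survivor as well. Deleting the survivors that share a block with another one leaves the
family (`exists_isLocalUSP_of_isMeanFree`), and a second-moment count shows that at least half are
left on average.

For the dichotomy, a rank-one flattening stays rank one in all powers, so `f` is at most 1 there; it
is at least 1 because a nonzero tensor restricts to the unit tensor of size one. The cases exclude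
each other since `c_k > 1`. -/

/-- The restriction of `f` to every affine line is a polynomial. -/
def PolyOnLines {L E : Type*} [Field L] [AddCommGroup E] [Module L E] (f : E → L) : Prop :=
  ∀ P v : E, ∃ r : Polynomial L, ∀ t : L, f (P + t • v) = r.eval t

namespace PolyOnLines

variable {L E : Type*} [Field L] [AddCommGroup E] [Module L E]

lemma const (c : L) : PolyOnLines (fun _ : E => c) :=
  fun _ _ => ⟨Polynomial.C c, fun t => by simp⟩

lemma linear (φ : E →ₗ[L] L) : PolyOnLines (fun x => φ x) := fun P v =>
  ⟨Polynomial.C (φ P) + Polynomial.C (φ v) * Polynomial.X, fun t => by simp [mul_comm t]⟩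

lemma add {f g : E → L} (hf : PolyOnLines f) (hg : PolyOnLines g) :
    PolyOnLines (fun x => f x + g x) := fun P v => by
  obtain ⟨r, hr⟩ := hf P v
  obtain ⟨s, hs⟩ := hg P v
  exact ⟨r + s, fun t => by simp [hr, hs]⟩

lemma mul {f g : E → L} (hf : PolyOnLines f) (hg : PolyOnLines g) :
    PolyOnLines (fun x => f x * g x) := fun P v => by
  obtain ⟨r, hr⟩ := hf P v
  obtain ⟨s, hs⟩ := hg P v
  exact ⟨r * s, fun t => by simp [hr, hs]⟩

lemma sub {f g : E → L} (hf : PolyOnLines f) (hg : PolyOnLines g) :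
    PolyOnLines (fun x => f x - g x) := by
  simpa [sub_eq_add_neg] using hf.add ((const (-1)).mul hg)

lemma sum {ι : Type*} {s : Finset ι} {f : ι → E → L} (hf : ∀ i ∈ s, PolyOnLines (f i)) :
    PolyOnLines (fun x => ∑ i ∈ s, f i x) := by
  classical
  induction s using Finset.induction_on with
  | empty => simpa using const (E := E) (0 : L)
  | insert a s ha ih =>
    simp only [Finset.sum_insert ha]
    exact (hf a (by simp)).add (ih fun i hi => hf i (by simp [hi]))

lemma prod {ι : Type*} {s : Finset ι} {f : ι → E → L} (hf : ∀ i ∈ s, PolyOnLines (f i)) :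
    PolyOnLines (fun x => ∏ i ∈ s, f i x) := by
  classical
  induction s using Finset.induction_on with
  | empty => simpa using const (E := E) (1 : L)
  | insert a s ha ih =>
    simp only [Finset.prod_insert ha]
    exact (hf a (by simp)).mul (ih fun i hi => hf i (by simp [hi]))

/-- On the line joining a point where `f` is nonzero to one where `g` is nonzero, both are nonzero
polynomials, and so is their product. This is the form in which generic points are chosen
throughout. -/
lemma exists_mul_ne_zero [Infinite L] {f g : E → L} (hf : PolyOnLines f) (hg : PolyOnLines g)
    (hf0 : ∃ x, f x ≠ 0) (hg0 : ∃ x, g x ≠ 0) : ∃ x, f x * g x ≠ 0 := by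
  obtain ⟨P, hP⟩ := hf0
  obtain ⟨Q, hQ⟩ := hg0
  obtain ⟨r, hr⟩ := hf P (Q - P)
  obtain ⟨s, hs⟩ := hg P (Q - P)
  by_contra! h
  have hrs : r * s = 0 := Polynomial.funext fun t => by
    rw [Polynomial.eval_mul, ← hr, ← hs, h, Polynomial.eval_zero]
  rcases mul_eq_zero.1 hrs with h0 | h0
  · exact hP (by simpa [h0] using hr 0)
  · exact hQ (by simpa [h0] using hs 1)

lemma exists_forall_ne_zero [Infinite L] {ι : Type*} (s : Finset ι) {f : ι → E → L}
    (hf : ∀ i ∈ s, PolyOnLines (f i)) (hf0 : ∀ i ∈ s, ∃ x, f i x ≠ 0) :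
    ∃ x, ∀ i ∈ s, f i x ≠ 0 := by
  classical
  suffices ∃ x, ∏ i ∈ s, f i x ≠ 0 from this.imp fun x hx i hi => Finset.prod_ne_zero_iff.1 hx i hi
  induction s using Finset.induction_on with
  | empty => exact ⟨0, by simp⟩
  | insert a s ha ih =>
    simp only [Finset.prod_insert ha]
    exact exists_mul_ne_zero (hf a (by simp)) (prod fun i hi => hf i (by simp [hi]))
      (hf0 a (by simp)) (ih (fun i hi => hf i (by simp [hi])) fun i hi => hf0 i (by simp [hi]))

end PolyOnLines

/-! ### The multilinear form of a tensor and separated groups of slots -/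

/-- The multilinear form `x ↦ ∑ a, (∏ i, x i (a i)) * T a` of a tensor. -/
noncomputable def mform {L : Type*} [Field L] {k : ℕ} {X : Fin k → Type*} [∀ i, Fintype (X i)]
    (T : (∀ i, X i) → L) : MultilinearMap L (fun i => X i → L) L :=
  ∑ a, T a • (MultilinearMap.mkPiAlgebra L (Fin k) L).compLinearMap
    (fun i => LinearMap.proj (a i))

lemma mform_apply {L : Type*} [Field L] {k : ℕ} {X : Fin k → Type*} [∀ i, Fintype (X i)]
    (T : (∀ i, X i) → L) (x : ∀ i, X i → L) :
    mform T x = ∑ a, (∏ i, x i (a i)) * T a := by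
  simp [mform, mul_comm]

section

variable {L : Type*} [Field L] {k : ℕ} {n : Fin k → ℕ}

lemma mform_single {X : Fin k → Type*} [∀ i, Fintype (X i)] [∀ i, DecidableEq (X i)]
    (T : (∀ i, X i) → L) (a : ∀ i, X i) :
    mform T (fun i => Pi.single (a i) 1) = T a := by
  rw [mform_apply, Finset.sum_eq_single a]
  · simp
  · intro b _ hb
    obtain ⟨i, hi⟩ := Function.ne_iff.1 hb
    rw [Finset.prod_eq_zero (Finset.mem_univ i) (by simp [hi]), zero_mul]
  · simp

/-- The slots in `A` and those in `B` are separated: the form behaves as a product of a form that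
does not depend on the slots in `B` and one that does not depend on the slots in `A`. -/
def Sep (T : KTensor L n) (A B : Finset (Fin k)) : Prop :=
  ∀ x x' : ∀ i, Fin (n i) → L,
    mform T x * mform T ((A ∪ B).piecewise x' x) =
      mform T (A.piecewise x' x) * mform T (B.piecewise x' x)

lemma Sep.symm {T : KTensor L n} {A B : Finset (Fin k)} (h : Sep T A B) : Sep T B A := by
  intro x x'
  rw [Finset.union_comm, h x x', mul_comm]

lemma polyOnLines_piecewise (T : KTensor L n) (A : Finset (Fin k)) :
    PolyOnLines (fun p : (∀ i, Fin (n i) → L) × (∀ i, Fin (n i) → L) =>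
      mform T (A.piecewise p.2 p.1)) := by
  simp only [mform_apply]
  refine PolyOnLines.sum fun a _ => (PolyOnLines.prod fun i _ => ?_).mul (PolyOnLines.const _)
  by_cases hi : i ∈ A
  · simp only [hi, Finset.piecewise_eq_of_mem]
    exact PolyOnLines.linear ((LinearMap.proj (a i)).comp ((LinearMap.proj i).comp
      (LinearMap.snd L (∀ i, Fin (n i) → L) (∀ i, Fin (n i) → L))))
  · simp only [hi, not_false_eq_true, Finset.piecewise_eq_of_notMem]
    exact PolyOnLines.linear ((LinearMap.proj (a i)).comp ((LinearMap.proj i).comp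
      (LinearMap.fst L (∀ i, Fin (n i) → L) (∀ i, Fin (n i) → L))))

lemma exists_mform_piecewise_ne_zero {T : KTensor L n} (hT : T ≠ 0) (A : Finset (Fin k)) :
    ∃ p : (∀ i, Fin (n i) → L) × (∀ i, Fin (n i) → L), mform T (A.piecewise p.2 p.1) ≠ 0 := by
  obtain ⟨a, ha⟩ := Function.ne_iff.1 hT
  refine ⟨(fun i => Pi.single (a i) 1, fun i => Pi.single (a i) 1), ?_⟩
  rw [Finset.piecewise_same, mform_single]
  exact ha

lemma piecewise_union {π : Fin k → Type*} (A B : Finset (Fin k)) (x x' : ∀ i, π i) :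
    B.piecewise x' (A.piecewise x' x) = (A ∪ B).piecewise x' x := by
  funext i
  by_cases hA : i ∈ A <;> by_cases hB : i ∈ B <;> simp [Finset.piecewise, hA, hB]

/-- The difference of the two sides of `Sep`. -/
noncomputable def sepMinor (T : KTensor L n) (A B : Finset (Fin k))
    (p : (∀ i, Fin (n i) → L) × (∀ i, Fin (n i) → L)) : L :=
  mform T p.1 * mform T ((A ∪ B).piecewise p.2 p.1) -
      mform T (A.piecewise p.2 p.1) * mform T (B.piecewise p.2 p.1)

lemma polyOnLines_sepMinor (T : KTensor L n) (A B : Finset (Fin k)) :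
    PolyOnLines (sepMinor T A B) := by
  have h := polyOnLines_piecewise T ∅
  simp only [Finset.piecewise_empty] at h
  exact (h.mul (polyOnLines_piecewise T _)).sub
    ((polyOnLines_piecewise T _).mul (polyOnLines_piecewise T _))

lemma exists_sepMinor_ne_zero {T : KTensor L n} {A B : Finset (Fin k)} (h : ¬ Sep T A B) :
    ∃ p, sepMinor T A B p ≠ 0 := by
  simp only [Sep, not_forall] at h
  obtain ⟨x, x', h⟩ := h
  exact ⟨(x, x'), sub_ne_zero.2 h⟩

/-- Times `F` at the point with the slots in `A` replaced, the minor for `A ∪ C` and `B` is a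
combination of the relation for `A`, `B` and the relation for `C`, `B` at a moved base point. That
factor is not identically zero and cancels. -/
lemma Sep.union [Infinite L] {T : KTensor L n} (hT : T ≠ 0) {A B C : Finset (Fin k)}
    (hA : Sep T A B) (hC : Sep T C B) : Sep T (A ∪ C) B := by
  by_contra h
  obtain ⟨⟨x, x'⟩, hp⟩ := (polyOnLines_piecewise T A).exists_mul_ne_zero
    (polyOnLines_sepMinor T (A ∪ C) B) (exists_mform_piecewise_ne_zero hT A)
    (exists_sepMinor_ne_zero h)
  apply hp
  have h1 := hA x x'
  have h2 := hC (A.piecewise x' x) x'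
  simp only [piecewise_union] at h2
  rw [← Finset.union_assoc] at h2
  simp only [sepMinor]
  linear_combination mform T x * h2 + mform T ((A ∪ C).piecewise x' x) * h1

lemma Sep.empty (T : KTensor L n) (B : Finset (Fin k)) : Sep T ∅ B := by
  intro x x'
  rw [Finset.empty_union, Finset.piecewise_empty]

lemma sep_of_forall_left [Infinite L] {T : KTensor L n} (hT : T ≠ 0) {A B : Finset (Fin k)}
    (h : ∀ i ∈ A, Sep T {i} B) : Sep T A B := by
  induction A using Finset.induction_on with
  | empty => exact Sep.empty T B
  | insert a s ha ih =>
    rw [Finset.insert_eq]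
    exact (h a (by simp)).union hT (ih fun i hi => h i (by simp [hi]))

lemma sep_of_forall [Infinite L] {T : KTensor L n} (hT : T ≠ 0) {A B : Finset (Fin k)}
    (h : ∀ i ∈ A, ∀ j ∈ B, Sep T {i} {j}) : Sep T A B :=
  sep_of_forall_left hT fun i hi =>
    (sep_of_forall_left hT fun j hj => (h i hi j hj).symm).symm

lemma mform_piecewise_single_add (T : KTensor L n) (A : Finset (Fin k)) {l : Fin k} (hl : l ∉ A)
    (x x' : ∀ i, Fin (n i) → L) :
    mform T (A.piecewise x' (Function.update x l (x l + x' l))) =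
      mform T (A.piecewise x' x) + mform T ((A ∪ {l}).piecewise x' x) := by
  have h : ∀ z, A.piecewise x' (Function.update x l z) =
      Function.update (A.piecewise x' x) l z := by
    intro z
    funext i
    rcases eq_or_ne i l with rfl | hi
    · simp [hl]
    · by_cases hA : i ∈ A <;> simp [Finset.piecewise, hA, hi]
  rw [h, MultilinearMap.map_update_add]
  congr 2
  · funext i
    rcases eq_or_ne i l with rfl | hi
    · simp [hl]
    · simp [hi]
  · funext i
    rcases eq_or_ne i l with rfl | hi
    · simp
    · by_cases hA : i ∈ A <;> simp [Finset.piecewise, hA, hi]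

/-- Contrapositively, non-separation is transitive. Imposing the relation for `i`, `j` with slot `l`
at `x l`, at `x' l` and at their sum polarizes it, and the product of the minors for `i`, `l` and
`j`, `l` vanishes identically; hence so does a factor. -/
lemma sep_trans [Infinite L] {T : KTensor L n} {i j l : Fin k} (hil : i ≠ l)
    (hjl : j ≠ l) (h : Sep T {i} {j}) : Sep T {i} {l} ∨ Sep T {j} {l} := by
  by_contra! hc
  obtain ⟨⟨x, x'⟩, hp⟩ := (polyOnLines_sepMinor T {i} {l}).exists_mul_ne_zero
    (polyOnLines_sepMinor T {j} {l}) (exists_sepMinor_ne_zero hc.1) (exists_sepMinor_ne_zero hc.2)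
  apply hp
  have h0 := h x x'
  have h1 := h (Finset.piecewise {l} x' x) x'
  have h2 := h (Function.update x l (x l + x' l)) x'
  have e := mform_piecewise_single_add T ∅ (l := l) (by simp) x x'
  rw [Finset.piecewise_empty, Finset.piecewise_empty, Finset.empty_union] at e
  rw [e, mform_piecewise_single_add T _ (by simp [hil.symm, hjl.symm]),
    mform_piecewise_single_add T _ (by simp [hil.symm]),
    mform_piecewise_single_add T _ (by simp [hjl.symm])] at h2
  simp only [piecewise_union] at h1
  rw [Finset.union_comm {l} ({i} ∪ {j}), Finset.union_comm {l} {i}, Finset.union_comm {l} {j}] at h1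
  simp only [sepMinor]
  set a := mform T x
  set b := mform T (Finset.piecewise {l} x' x)
  linear_combination (a * b) * h2 - (a * b + b * b) * h0 - (a * a + a * b) * h1

/-- `I` is the non-separation class of `i`: by transitivity each of its slots is separated from each
slot outside. -/
lemma exists_sep_compl [Infinite L] {T : KTensor L n} (hT : T ≠ 0) {i j : Fin k} (hij : i ≠ j)
    (h : Sep T {i} {j}) : ∃ I : Finset (Fin k), i ∈ I ∧ j ∉ I ∧ Sep T I Iᶜ := by
  classical
  refine ⟨Finset.univ.filter fun l => l = i ∨ ¬ Sep T {l} {i}, by simp,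
    by simp [hij.symm, h.symm], sep_of_forall hT fun l hl m hm => ?_⟩
  simp only [Finset.mem_filter, Finset.mem_univ, true_and, Finset.mem_compl, not_or, not_not]
    at hl hm
  rcases eq_or_ne l i with rfl | hli
  · exact hm.2.symm
  · have hl' := hl.resolve_left hli
    rcases eq_or_ne l m with rfl | hlm
    · exact absurd hm.2 hl'
    · exact ((sep_trans hlm.symm hli.symm hm.2).resolve_right fun h' => hl' h'.symm).symm

end

/-! ### Rank-one matrices and flattenings -/

lemma rank_eq_one_of_minors {K m n : Type*} [Field K] [Fintype n] {M : Matrix m n K}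
    (h : ∀ r r' c c', M r c * M r' c' = M r c' * M r' c) (hM : M ≠ 0) : M.rank = 1 := by
  obtain ⟨r, hr⟩ := Function.ne_iff.1 hM
  obtain ⟨c, hc⟩ := Function.ne_iff.1 hr
  replace hc : M r c ≠ 0 := hc
  have hv : M = Matrix.vecMulVec (fun i => M i c) (fun j => M r j / M r c) := by
    ext i j
    rw [Matrix.vecMulVec_apply, ← mul_div_assoc, h i r c j, mul_div_cancel_right₀ _ hc]
  refine le_antisymm ?_ ?_
  · rw [hv]
    exact Matrix.rank_vecMulVec_le _ _
  · rw [Nat.one_le_iff_ne_zero]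
    intro h0
    classical
    have h1 := LinearMap.range_eq_bot.1 (Submodule.finrank_eq_zero.1 h0)
    apply hc
    simpa using congr_fun (LinearMap.congr_fun h1 (Pi.single c 1)) r

section

variable {K : Type*} [Field K] {k : ℕ} {n : Fin k → ℕ}

lemma rank_flattening_eq_one {T : KTensor K n} (hT : T ≠ 0) (I : Finset (Fin k))
    (h : ∀ a a' : ∀ i, Fin (n i),
      T a * T a' = T (I.piecewise a' a) * T (Iᶜ.piecewise a' a)) :
    (flattening T I).rank = 1 := by
  refine rank_eq_one_of_minors (fun r r' c c' => ?_) fun h0 => hT ?_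
  · simp only [flattening, Matrix.of_apply]
    rw [h, mul_comm]
    congr 2 <;>
    · funext i
      by_cases hi : i ∈ I <;> simp [Finset.piecewise, hi]
  · funext a
    have := congr_fun (congr_fun h0 fun i => a i) fun i => a i
    simpa [flattening] using this

/-- A tensor regarded over an extension field. -/
def extend {X : Fin k → Type*} (L : Type*) [Field L] [Algebra K L] (T : (∀ i, X i) → K) :
    (∀ i, X i) → L :=
  fun a => algebraMap K L (T a)

variable {L : Type*} [Field L] [Algebra K L]

lemma extend_ne_zero {T : KTensor K n} (hT : T ≠ 0) : extend L T ≠ 0 := by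
  intro h
  apply hT
  funext a
  have := congr_fun h a
  simpa [extend] using this

lemma mform_extend {X : Fin k → Type*} [∀ i, Fintype (X i)] (T : (∀ i, X i) → K)
    (x : ∀ i, X i → K) :
    mform (extend L T) (fun i a => algebraMap K L (x i a)) = algebraMap K L (mform T x) := by
  simp [mform_apply, extend]

/-- At standard basis vectors the separation identity expresses the 2×2 minors of the flattening,
whose entries lie in `K`. -/
lemma hasRankOneFlattening_of_sep {T : KTensor K n} (hT : T ≠ 0) {I : Finset (Fin k)}
    {i j : Fin k} (hi : i ∈ I) (hj : j ∉ I) (h : Sep (extend L T) I Iᶜ) :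
    HasRankOneFlattening T := by
  refine ⟨I, ⟨⟨i, hi⟩, fun h' => hj (h' ▸ Finset.mem_univ j)⟩, rank_flattening_eq_one hT I ?_⟩
  intro a a'
  have := h (fun i => Pi.single (a i) 1) (fun i => Pi.single (a' i) 1)
  have hp : ∀ A : Finset (Fin k), mform (extend L T)
      (A.piecewise (fun i => Pi.single (a' i) 1) (fun i => Pi.single (a i) 1)) =
        algebraMap K L (T (A.piecewise a' a)) := by
    intro A
    rw [← extend, ← mform_single (extend L T)]
    congr 1
    funext i
    by_cases hi : i ∈ A <;> simp [hi]
  rw [hp, hp, hp, mform_single, extend, Finset.union_compl, Finset.piecewise_univ,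
    ← map_mul, ← map_mul] at this
  exact (algebraMap K L).injective this

/-! ### Descent of separation to an extension field -/

/-- The coefficients of a quadratic form can be read off at `e_a` and `e_a + e_b`, so even the
points over a two-element field suffice. -/
lemma bilin_self_eq_zero {m : ℕ} (β : (Fin m → L) →ₗ[L] (Fin m → L) →ₗ[L] L)
    (h : ∀ y : Fin m → K, β (fun a => algebraMap K L (y a)) (fun a => algebraMap K L (y a)) = 0)
    (z : Fin m → L) : β z z = 0 := by
  have hs : ∀ a : Fin m, (fun b => algebraMap K L ((Pi.single a 1 : Fin m → K) b)) =
      (Pi.single a 1 : Fin m → L) := by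
    intro a
    funext b
    rcases eq_or_ne b a with rfl | hb <;> simp [*]
  have h1 : ∀ a : Fin m, β (Pi.single a 1) (Pi.single a 1) = 0 := fun a => by
    have := h (Pi.single a 1)
    rwa [hs] at this
  have h2 : ∀ a b : Fin m, β (Pi.single a 1) (Pi.single b 1) = -β (Pi.single b 1) (Pi.single a 1) := by
    intro a b
    have := h (Pi.single a 1 + Pi.single b 1)
    have he : (fun c => algebraMap K L ((Pi.single a 1 + Pi.single b 1 : Fin m → K) c)) =
        (Pi.single a 1 : Fin m → L) + Pi.single b 1 := by
      rw [← hs a, ← hs b]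
      funext c
      simp
    rw [he] at this
    simp only [map_add, LinearMap.add_apply, h1] at this
    linear_combination this
  have hz : z = ∑ a, z a • (Pi.single a 1 : Fin m → L) := by
    simpa using (pi_eq_sum_univ' z)
  have halt : ∀ (s : Finset (Fin m)) (c : Fin m → L),
      β (∑ a ∈ s, c a • (Pi.single a 1 : Fin m → L)) (∑ a ∈ s, c a • Pi.single a 1) = 0 := by
    intro s c
    induction s using Finset.induction_on with
    | empty => simp
    | insert a s ha ih =>
      rw [Finset.sum_insert ha]
      have hanti : β.flip (Pi.single a 1) = -β (Pi.single a 1) := by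
        refine LinearMap.pi_ext' fun b => LinearMap.ext_ring ?_
        simpa using h2 b a
      have hv := LinearMap.congr_fun hanti (∑ a ∈ s, c a • (Pi.single a 1 : Fin m → L))
      rw [LinearMap.flip_apply, LinearMap.neg_apply] at hv
      rw [LinearMap.map_add₂, map_add, map_add, ih, LinearMap.map_smul₂, map_smul, LinearMap.map_smul₂,
        map_smul, hv, h1]
      simp
  rw [hz]
  exact halt _ _

lemma bilin_eq_zero {m : ℕ} (β : (Fin m → L) →ₗ[L] (Fin m → L) →ₗ[L] L)
    (h : ∀ y y' : Fin m → K,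
      β (fun a => algebraMap K L (y a)) (fun a => algebraMap K L (y' a)) = 0) : β = 0 := by
  have hs : ∀ a : Fin m, (fun b => algebraMap K L ((Pi.single a 1 : Fin m → K) b)) =
      (Pi.single a 1 : Fin m → L) := by
    intro a
    funext b
    rcases eq_or_ne b a with rfl | hb <;> simp [*]
  refine LinearMap.pi_ext' fun a => LinearMap.ext_ring ?_
  refine LinearMap.pi_ext' fun b => LinearMap.ext_ring ?_
  have := h (Pi.single a 1) (Pi.single b 1)
  simpa [hs] using this

/-- The bilinear map `(z, w) ↦ f z * g w - f' z * g' w`. -/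
noncomputable def mulSubMul {E : Type*} [AddCommGroup E] [Module L E] (f g f' g' : E →ₗ[L] L) :
    E →ₗ[L] E →ₗ[L] L :=
  (LinearMap.mul L L).compl₁₂ f g - (LinearMap.mul L L).compl₁₂ f' g'

lemma update_piecewise_mem {π : Fin k → Type*} {A : Finset (Fin k)} {l : Fin k} (hl : l ∈ A)
    (x x' : ∀ i, π i) (z w : π l) :
    A.piecewise (Function.update x' l w) (Function.update x l z) =
      Function.update (A.piecewise x' x) l w := by
  funext i
  rcases eq_or_ne i l with rfl | hi
  · simp [hl]
  · by_cases hA : i ∈ A <;> simp [Finset.piecewise, hA, hi]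

lemma update_piecewise_notMem {π : Fin k → Type*} {A : Finset (Fin k)} {l : Fin k} (hl : l ∉ A)
    (x x' : ∀ i, π i) (z w : π l) :
    A.piecewise (Function.update x' l w) (Function.update x l z) =
      Function.update (A.piecewise x' x) l z := by
  funext i
  rcases eq_or_ne i l with rfl | hi
  · simp [hl]
  · by_cases hA : i ∈ A <;> simp [Finset.piecewise, hA, hi]

/-- Needed because `K` may be finite. Slots are released from `K` to `L` one at a time (`J` holds
the released ones): the minor is bilinear in `(x l, x' l)` for `l = i` or `l = j`, and a quadratic
form in `x l` alone otherwise. In both cases vanishing at the vectors over `K` forces vanishing. -/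
lemma sep_extend {T : KTensor K n} {i j : Fin k} (hij : i ≠ j) (h : Sep T {i} {j}) :
    Sep (extend L T) {i} {j} := by
  classical
  suffices H : ∀ J : Finset (Fin k), ∀ x x' : ∀ l, Fin (n l) → L,
      (∀ l ∉ J, ∃ y : Fin (n l) → K, x l = fun a => algebraMap K L (y a)) →
      (∀ l ∉ J, ∃ y : Fin (n l) → K, x' l = fun a => algebraMap K L (y a)) →
      sepMinor (extend L T) {i} {j} (x, x') = 0 by
    intro x x'
    exact sub_eq_zero.1 (H Finset.univ x x' (by simp) (by simp))
  intro J
  induction J using Finset.induction_on with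
  | empty =>
    intro x x' hx hx'
    choose y hy using fun l => hx l (by simp)
    choose y' hy' using fun l => hx' l (by simp)
    obtain rfl : x = fun l a => algebraMap K L (y l a) := funext hy
    obtain rfl : x' = fun l a => algebraMap K L (y' l a) := funext hy'
    have hp : ∀ A : Finset (Fin k), A.piecewise (fun l a => algebraMap K L (y' l a))
        (fun l a => algebraMap K L (y l a)) =
          fun l a => algebraMap K L (A.piecewise y' y l a) := by
      intro A
      funext l a
      by_cases hl : l ∈ A <;> simp [hl]
    simp only [sepMinor, hp, mform_extend, ← map_mul, h y y', sub_self]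
  | insert l J hl ih =>
    intro x x' hx hx'
    have key : ∀ y y' : Fin (n l) → K, sepMinor (extend L T) {i} {j}
        (Function.update x l (fun a => algebraMap K L (y a)),
          Function.update x' l (fun a => algebraMap K L (y' a))) = 0 := by
      intro y y'
      refine ih _ _ (fun m hm => ?_) (fun m hm => ?_)
      · rcases eq_or_ne m l with rfl | hml
        · exact ⟨y, by simp⟩
        · simpa [hml] using hx m (by simp [hm, hml])
      · rcases eq_or_ne m l with rfl | hml
        · exact ⟨y', by simp⟩
        · simpa [hml] using hx' m (by simp [hm, hml])
    have hxx : sepMinor (extend L T) {i} {j} (x, x') = sepMinor (extend L T) {i} {j}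
        (Function.update x l (x l), Function.update x' l (x' l)) := by simp
    rw [hxx]
    set M := fun A : Finset (Fin k) =>
      (mform (extend L T)).toLinearMap (A.piecewise x' x) l with hM
    have hMa : ∀ A z, M A z = mform (extend L T) (Function.update (A.piecewise x' x) l z) :=
      fun A z => rfl
    have hM0 : ∀ z, M ∅ z = mform (extend L T) (Function.update x l z) := by
      intro z
      rw [hMa, Finset.piecewise_empty]
    by_cases hli : l = i
    · subst hli
      have e : ∀ z w, mulSubMul (M ∅) (M ({l} ∪ {j})) (M {j}) (M {l}) z w =
          sepMinor (extend L T) {l} {j} (Function.update x l z, Function.update x' l w) := by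
        intro z w
        simp only [sepMinor, mulSubMul]
        rw [update_piecewise_mem (by simp), update_piecewise_mem (by simp),
          update_piecewise_notMem (by simpa using hij)]
        simp only [LinearMap.sub_apply, LinearMap.compl₁₂_apply, LinearMap.mul_apply', hM0, hMa]
        ring
      rw [← e, bilin_eq_zero (K := K) (mulSubMul (M ∅) (M ({l} ∪ {j})) (M {j}) (M {l}))]
      · simp
      · intro y y'
        rw [e, key]
    by_cases hlj : l = j
    · subst hlj
      have e : ∀ z w, mulSubMul (M ∅) (M ({i} ∪ {l})) (M {i}) (M {l}) z w =
          sepMinor (extend L T) {i} {l} (Function.update x l z, Function.update x' l w) := by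
        intro z w
        simp only [sepMinor, mulSubMul]
        rw [update_piecewise_mem (by simp), update_piecewise_notMem (by simpa using hli),
          update_piecewise_mem (by simp)]
        simp only [LinearMap.sub_apply, LinearMap.compl₁₂_apply, LinearMap.mul_apply', hM0, hMa]
      rw [← e, bilin_eq_zero (K := K) (mulSubMul (M ∅) (M ({i} ∪ {l})) (M {i}) (M {l}))]
      · simp
      · intro y y'
        rw [e, key]
    · have e : ∀ z w, mulSubMul (M ∅) (M ({i} ∪ {j})) (M {i}) (M {j}) z z =
          sepMinor (extend L T) {i} {j} (Function.update x l z, Function.update x' l w) := by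
        intro z w
        simp only [sepMinor, mulSubMul]
        rw [update_piecewise_notMem (by simp [hli, hlj]), update_piecewise_notMem (by simpa using hli),
          update_piecewise_notMem (by simpa using hlj)]
        simp only [LinearMap.sub_apply, LinearMap.compl₁₂_apply, LinearMap.mul_apply', hM0, hMa]
      rw [← e, bilin_self_eq_zero (K := K) (mulSubMul (M ∅) (M ({i} ∪ {j})) (M {i}) (M {j}))]
      intro y
      rw [e _ (fun a => algebraMap K L (y a)), key]

lemma not_sep_extend (L : Type*) [Field L] [Algebra K L] [Infinite L] {T : KTensor K n}
    (hT : T ≠ 0) (h1 : ¬ HasRankOneFlattening T) {i j : Fin k} (hij : i ≠ j) :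
    ¬ Sep (extend L T) {i} {j} := by
  intro h
  obtain ⟨I, hi, hj, hI⟩ := exists_sep_compl (extend_ne_zero hT) hij h
  exact h1 (hasRankOneFlattening_of_sep hT hi hj hI)

/-- The transitivity argument needs an infinite field, hence the detour through the algebraic
closure. -/
lemma not_sep {T : KTensor K n} (hT : T ≠ 0) (h1 : ¬ HasRankOneFlattening T) {i j : Fin k}
    (hij : i ≠ j) : ¬ Sep T {i} {j} :=
  fun h => not_sep_extend (AlgebraicClosure K) hT h1 hij (sep_extend hij h)

/-! ### A zero of the form at which no partial derivative vanishes -/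

lemma update_eq_piecewise {π : Fin k → Type*} (x x' : ∀ i, π i) (i : Fin k) :
    Function.update x i (x' i) = Finset.piecewise {i} x' x := by
  rw [Finset.piecewise_singleton]

/-- Start at a generic point, where the minors of slot `o` with all other slots are nonzero. Moving
slot `o` so that the form vanishes turns the partial derivatives in the other slots into these
minors, up to sign. -/
lemma exists_nondegenerate_zero [Infinite K] (hk : 2 ≤ k) {T : KTensor K n}
    (h : ∀ i j : Fin k, i ≠ j → ¬ Sep T {i} {j}) :
    ∃ x y : ∀ i, Fin (n i) → K, mform T x = 0 ∧
      ∀ i, mform T (Function.update x i (y i)) ≠ 0 := by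
  classical
  let o : Fin k := ⟨0, by omega⟩
  obtain ⟨⟨x, x'⟩, hp⟩ := PolyOnLines.exists_forall_ne_zero (Finset.univ.erase o)
    (f := fun i => sepMinor T {o} {i}) (fun i _ => polyOnLines_sepMinor T _ _)
    (fun i hi => exists_sepMinor_ne_zero (h o i (Finset.ne_of_mem_erase hi).symm))
  set a := mform T x with ha
  set b := mform T (Finset.piecewise {o} x' x) with hb
  -- The form takes the values `a` and `b` when slot `o` holds `x o` and `x' o`, so it vanishes at
  -- this combination.
  let w := b • x o - a • x' o
  let z := Function.update x o w
  have hz : ∀ v, mform T (Function.update z o v) = mform T (Function.update x o v) := by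
    intro v
    simp [z]
  have hz0 : mform T z = 0 := by
    simp only [z, w, MultilinearMap.map_update_sub, MultilinearMap.map_update_smul]
    rw [Function.update_eq_self, update_eq_piecewise, ← hb, ← ha]
    simp [mul_comm]
  have hzi : ∀ i, i ≠ o → mform T (Function.update z i (x' i)) = -sepMinor T {o} {i} (x, x') := by
    intro i hi
    simp only [z, w]
    rw [Function.update_comm hi.symm, MultilinearMap.map_update_sub,
      MultilinearMap.map_update_smul, MultilinearMap.map_update_smul]
    have h1 : Function.update (Function.update x i (x' i)) o (x o) =
        Finset.piecewise {i} x' x := by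
      rw [← update_eq_piecewise, Function.update_eq_self_iff]
      simp [hi.symm]
    have h2 : Function.update (Function.update x i (x' i)) o (x' o) =
        Finset.piecewise ({o} ∪ {i}) x' x := by
      rw [← piecewise_union, ← update_eq_piecewise, ← update_eq_piecewise,
        Function.update_comm hi.symm]
    rw [h1, h2, sepMinor, ← ha, ← hb, smul_eq_mul, smul_eq_mul]
    ring
  -- If both vanished, so would the minor of slot `o` with a second slot, which exists as `2 ≤ k`.
  have hab : a ≠ 0 ∨ b ≠ 0 := by
    by_contra! hab
    have h1o : (⟨1, by omega⟩ : Fin k) ≠ o := by simp [o, Fin.ext_iff]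
    refine hp ⟨1, by omega⟩ (by simp [h1o]) ?_
    simp only [sepMinor, ← ha, ← hb, hab.1, hab.2]
    ring
  obtain ⟨v, hv⟩ : ∃ v, mform T (Function.update x o v) ≠ 0 := by
    rcases hab with hab | hab
    · exact ⟨x o, by rwa [Function.update_eq_self]⟩
    · exact ⟨x' o, by rwa [update_eq_piecewise]⟩
  refine ⟨z, Function.update x' o v, hz0, fun i => ?_⟩
  rcases eq_or_ne i o with rfl | hi
  · rw [hz]
    simpa using hv
  · rw [Function.update_of_ne hi, hzi i hi, neg_ne_zero]
    exact hp i (by simp [hi])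

end

/-- After a finite field extension, a tensor without rank-one flattenings has a zero at which no
partial derivative of its multilinear form vanishes. -/
lemma exists_finite_extension_zero {K : Type*} [Field K] {k : ℕ} {n : Fin k → ℕ} (hk : 2 ≤ k)
    {T : KTensor K n} (hT : T ≠ 0) (h1 : ¬ HasRankOneFlattening T) :
    ∃ (L : IntermediateField K (AlgebraicClosure K)) (_ : FiniteDimensional K L)
      (x y : ∀ i, Fin (n i) → L), mform (extend L T) x = 0 ∧
        ∀ i, mform (extend L T) (Function.update x i (y i)) ≠ 0 := by
  classical
  obtain ⟨x, y, hx, hy⟩ := exists_nondegenerate_zero hk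
    fun i j hij => not_sep_extend (AlgebraicClosure K) hT h1 hij
  let S : Set (AlgebraicClosure K) :=
    (Set.range fun p : Σ i, Fin (n i) => x p.1 p.2) ∪ Set.range fun p : Σ i, Fin (n i) => y p.1 p.2
  let L := IntermediateField.adjoin K S
  have hxS : ∀ i a, x i a ∈ L := fun i a =>
    IntermediateField.subset_adjoin K S (Or.inl ⟨⟨i, a⟩, rfl⟩)
  have hyS : ∀ i a, y i a ∈ L := fun i a =>
    IntermediateField.subset_adjoin K S (Or.inr ⟨⟨i, a⟩, rfl⟩)
  have hfin : S.Finite := (Set.finite_range _).union (Set.finite_range _)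
  have : Finite S := hfin
  refine ⟨L, IntermediateField.finiteDimensional_adjoin fun s _ => Algebra.IsIntegral.isIntegral s,
    fun i a => ⟨x i a, hxS i a⟩, fun i a => ⟨y i a, hyS i a⟩, ?_, fun i => ?_⟩
  · apply (algebraMap L (AlgebraicClosure K)).injective
    rw [map_zero, ← hx, mform_apply, mform_apply]
    simp [extend]
  · intro h0
    apply hy i
    rw [← map_zero (algebraMap L (AlgebraicClosure K)), ← h0, mform_apply, mform_apply]
    simp only [map_sum, map_mul, map_prod]
    refine Finset.sum_congr rfl fun a _ => ?_
    congr 1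
    refine Finset.prod_congr rfl fun j _ => ?_
    rcases eq_or_ne j i with rfl | hj
    · simp
    · simp [hj]

/-! ### Restriction to unit tensors -/

section

variable {K : Type*} [Field K] {k : ℕ}

/-- The tensor `T` restricts to the unit tensor with index set `ρ`. -/
def Diag {X : Fin k → Type*} [∀ i, Fintype (X i)] (T : (∀ i, X i) → K) (ρ : Type*) : Prop :=
  ∃ B : ∀ i, ρ → X i → K, (∀ c, mform T (fun i => B i c) = 1) ∧
    ∀ b : Fin k → ρ, (¬ ∀ i i', b i = b i') → mform T (fun i => B i (b i)) = 0

/-- The tensor product of two tensors, slot by slot. -/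
def tensorProd {X Y : Fin k → Type*} (T : (∀ i, X i) → K) (S : (∀ i, Y i) → K) :
    (∀ i, X i × Y i) → K :=
  fun a => T (fun i => (a i).1) * S (fun i => (a i).2)

/-- The power of a tensor with copies indexed by `ι`. -/
def powTensor {X : Fin k → Type*} (T : (∀ i, X i) → K) (ι : Type*) [Fintype ι] :
    (∀ i, ι → X i) → K :=
  fun a => ∏ j, T (fun i => a i j)

lemma extend_powTensor {X : Fin k → Type*} {ι : Type*} [Fintype ι] (L : Type*) [Field L] [Algebra K L]
    (T : (∀ i, X i) → K) : extend L (powTensor T ι) = powTensor (extend L T) ι := by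
  funext a
  simp [extend, powTensor]

lemma powTensor_ne_zero {X : Fin k → Type*} {T : (∀ i, X i) → K} (hT : T ≠ 0) (ι : Type*) [Fintype ι] :
    powTensor T ι ≠ 0 := by
  obtain ⟨a, ha⟩ := Function.ne_iff.1 hT
  refine Function.ne_iff.2 ⟨fun i _ => a i, ?_⟩
  exact Finset.prod_ne_zero_iff.2 fun _ _ => ha

variable {X Y : Fin k → Type*} [∀ i, Fintype (X i)] [∀ i, Fintype (Y i)]

lemma mform_tensorProd (T : (∀ i, X i) → K) (S : (∀ i, Y i) → K) (x : ∀ i, X i → K)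
    (y : ∀ i, Y i → K) :
    mform (tensorProd T S) (fun i p => x i p.1 * y i p.2) = mform T x * mform S y := by
  simp only [mform_apply, Finset.sum_mul_sum]
  rw [← Finset.sum_product', ← (Equiv.arrowProdEquivProdArrow (Fin k) X Y).symm.sum_comp]
  refine Finset.sum_congr rfl fun a _ => ?_
  simp only [tensorProd, Equiv.arrowProdEquivProdArrow, Equiv.coe_fn_symm_mk, Finset.prod_mul_distrib]
  ring

lemma mform_equiv (T : (∀ i, X i) → K) (e : ∀ i, Y i ≃ X i) (x : ∀ i, X i → K) :
    mform (fun a => T fun i => e i (a i)) (fun i a => x i (e i a)) = mform T x := by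
  simp only [mform_apply]
  exact (Equiv.piCongrRight e).sum_comp fun a => (∏ i, x i (a i)) * T a

lemma mform_powTensor {ι : Type*} [Fintype ι] [DecidableEq ι] (T : (∀ i, X i) → K)
    (v : ∀ i, ι → X i → K) :
    mform (powTensor T ι) (fun i a => ∏ j, v i j (a j)) = ∏ j, mform T (fun i => v i j) := by
  simp only [mform_apply, powTensor]
  rw [Finset.prod_univ_sum, Fintype.piFinset_univ, ← (Equiv.piComm fun (_ : ι) i => X i).sum_comp]
  refine Finset.sum_congr rfl fun a _ => ?_
  rw [Finset.prod_comm, ← Finset.prod_mul_distrib]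
  rfl

lemma Diag.comap {T : (∀ i, X i) → K} {ρ σ : Type*} (h : Diag T ρ) {g : σ → ρ}
    (hg : Function.Injective g) : Diag T σ := by
  obtain ⟨B, h1, h0⟩ := h
  refine ⟨fun i c => B i (g c), fun c => h1 _, fun b hb => h0 (fun i => g (b i)) fun h => hb ?_⟩
  exact fun i i' => hg (h i i')

lemma Diag.of_equiv {T : (∀ i, X i) → K} {S : (∀ i, Y i) → K} {ρ : Type*} (h : Diag T ρ)
    (e : ∀ i, Y i ≃ X i) (hS : ∀ a, S a = T fun i => e i (a i)) : Diag S ρ := by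
  obtain rfl : S = fun a => T fun i => e i (a i) := funext hS
  obtain ⟨B, h1, h0⟩ := h
  refine ⟨fun i c a => B i c (e i a), fun c => ?_, fun b hb => ?_⟩
  · rw [← h1 c]
    exact mform_equiv T e fun i => B i c
  · rw [← h0 b hb]
    exact mform_equiv T e fun i => B i (b i)

/-- Rescaling the vectors of a single slot normalizes the diagonal values. -/
lemma Diag.of_ne_zero (hk : 0 < k) {T : (∀ i, X i) → K} {ρ : Type*} (B : ∀ i, ρ → X i → K)
    (h1 : ∀ c, mform T (fun i => B i c) ≠ 0)
    (h0 : ∀ b : Fin k → ρ, (¬ ∀ i i', b i = b i') → mform T (fun i => B i (b i)) = 0) :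
    Diag T ρ := by
  classical
  let o : Fin k := ⟨0, hk⟩
  let s : Fin k → ρ → K := fun i c => if i = o then (mform T fun i => B i c)⁻¹ else 1
  have hs : ∀ b : Fin k → ρ, mform T (fun i => s i (b i) • B i (b i)) =
      (mform T fun i => B i (b o))⁻¹ * mform T (fun i => B i (b i)) := by
    intro b
    rw [MultilinearMap.map_smul_univ, smul_eq_mul]
    congr 1
    simp [s]
  refine ⟨fun i c => s i c • B i c, fun c => ?_, fun b hb => ?_⟩
  · rw [hs fun _ => c, inv_mul_cancel₀ (h1 c)]
  · rw [hs, h0 b hb, mul_zero]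

lemma Diag.tprod {T : (∀ i, X i) → K} {S : (∀ i, Y i) → K} {ρ σ : Type*} (hT : Diag T ρ)
    (hS : Diag S σ) : Diag (tensorProd T S) (ρ × σ) := by
  obtain ⟨B, h1, h0⟩ := hT
  obtain ⟨B', h1', h0'⟩ := hS
  refine ⟨fun i c p => B i c.1 p.1 * B' i c.2 p.2, fun c => ?_, fun b hb => ?_⟩
  · rw [mform_tensorProd T S (fun i => B i c.1) (fun i => B' i c.2), h1, h1', mul_one]
  · rw [mform_tensorProd T S (fun i => B i (b i).1) (fun i => B' i (b i).2)]
    by_cases hb1 : ∀ i i', (b i).1 = (b i').1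
    · rw [h0' (fun i => (b i).2), mul_zero]
      exact fun hb2 => hb fun i i' => Prod.ext (hb1 i i') (hb2 i i')
    · rw [h0 (fun i => (b i).1) hb1, zero_mul]

/-- If a unit tensor is a sum, with summands indexed by `R`, of restrictions of `T`, and `S`
restricts to the unit tensor of size `R`, then `T ⊗ S` restricts to the former unit tensor. -/
lemma Diag.tprod_of_sum (hk : 0 < k) {T : (∀ i, X i) → K} {S : (∀ i, Y i) → K} {ρ R : Type*}
    [Fintype R] (A : ∀ i, R → ρ → X i → K) (h1 : ∀ c, ∑ s, mform T (fun i => A i s c) = 1)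
    (h0 : ∀ b : Fin k → ρ, (¬ ∀ i i', b i = b i') → ∑ s, mform T (fun i => A i s (b i)) = 0)
    (hS : Diag S R) : Diag (tensorProd T S) ρ := by
  classical
  obtain ⟨E, e1, e0⟩ := hS
  -- Multilinear expansion gives a term for each function `Fin k → R`; the unit tensor coming from
  -- `S` keeps only the constant ones.
  have key : ∀ b : Fin k → ρ, mform (tensorProd T S)
      (fun i => ∑ s, fun p : X i × Y i => A i s (b i) p.1 * E i s p.2) =
        ∑ s, mform T (fun i => A i s (b i)) := by
    intro b
    rw [MultilinearMap.map_sum]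
    simp only [mform_tensorProd T S (fun i => A i _ (b i)) (fun i => E i _)]
    let o : Fin k := ⟨0, hk⟩
    have hinj : Function.Injective (fun (s : R) (_ : Fin k) => s) := fun s t h => congr_fun h o
    rw [← Finset.sum_subset (Finset.subset_univ (Finset.univ.image fun (s : R) (_ : Fin k) => s)),
      Finset.sum_image fun s _ t _ h => hinj h]
    · refine Finset.sum_congr rfl fun s _ => ?_
      rw [e1, mul_one]
    · intro s _ hs
      rw [e0, mul_zero]
      intro hc
      exact hs (Finset.mem_image.2 ⟨s o, Finset.mem_univ _, funext fun i => hc o i⟩)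
  refine ⟨fun i c => ∑ s, fun p => A i s c p.1 * E i s p.2, fun c => ?_, fun b hb => ?_⟩
  · rw [key fun _ => c, h1]
  · rw [key b, h0 b hb]

/-- A restriction to a unit tensor over a finite extension of degree `d` can be carried out over
the ground field, at the cost of a factor restricting to the unit tensor of size `d ^ k`. -/
lemma Diag.tprod_of_extend (hk : 0 < k) {L : Type*} [Field L] [Algebra K L]
    [FiniteDimensional K L] {T : (∀ i, X i) → K} {S : (∀ i, Y i) → K} {ρ : Type*}
    (hT : Diag (extend L T) ρ) (hS : Diag S (Fin k → Fin (Module.finrank K L))) :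
    Diag (tensorProd T S) ρ := by
  classical
  obtain ⟨B, h1, h0⟩ := hT
  let β := Module.finBasis K L
  -- Expanding all vectors in a `K`-basis of `L` produces products of `k` basis elements, indexed by
  -- `s`. A `K`-linear `φ` with `φ 1 = 1` turns them into scalars `w s` in `K` and preserves the
  -- required values 0 and 1; each scalar is put into slot `o` only.
  obtain ⟨φ, hφ⟩ : ∃ φ : L →ₗ[K] K, φ 1 = 1 := by
    obtain ⟨g, hg⟩ := LinearMap.exists_leftInverse_of_injective (Algebra.linearMap K L)
      (LinearMap.ker_eq_bot.2 (algebraMap K L).injective)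
    refine ⟨g, ?_⟩
    have := LinearMap.congr_fun hg 1
    simpa using this
  let o : Fin k := ⟨0, hk⟩
  let w : (Fin k → Fin (Module.finrank K L)) → K := fun s => φ (∏ i, β (s i))
  let A : ∀ i, (Fin k → Fin (Module.finrank K L)) → ρ → X i → K :=
    fun i s c => (if i = o then w s else 1) • fun x => β.repr (B i c x) (s i)
  have key : ∀ b : Fin k → ρ, ∑ s, mform T (fun i => A i s (b i)) =
      φ (mform (extend L T) fun i => B i (b i)) := by
    intro b
    have hA : ∀ s, mform T (fun i => A i s (b i)) =
        w s * mform T (fun i x => β.repr (B i (b i) x) (s i)) := by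
      intro s
      simp only [A]
      rw [MultilinearMap.map_smul_univ, smul_eq_mul]
      congr 1
      simp
    simp only [hA, mform_apply, extend, map_sum, Finset.mul_sum]
    rw [Finset.sum_comm]
    refine Finset.sum_congr rfl fun a _ => ?_
    have hx : ∏ i, B i (b i) (a i) = ∑ s : Fin k → Fin (Module.finrank K L),
        (∏ i, β.repr (B i (b i) (a i)) (s i)) • ∏ i, β (s i) := by
      calc ∏ i, B i (b i) (a i)
          = ∏ i, ∑ j, β.repr (B i (b i) (a i)) j • β j := by simp only [β.sum_repr]
        _ = _ := by
          rw [Finset.prod_univ_sum, Fintype.piFinset_univ]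
          simp only [Finset.prod_smul]
    rw [hx, mul_comm, ← Algebra.smul_def, map_smul, map_sum, smul_eq_mul, mul_comm, Finset.sum_mul]
    refine Finset.sum_congr rfl fun s _ => ?_
    rw [map_smul, smul_eq_mul]
    ring
  refine Diag.tprod_of_sum hk A (fun c => ?_) (fun b hb => ?_) hS
  · rw [key fun _ => c, h1, hφ]
  · rw [key b, h0 b hb, map_zero]

/-! ### Powers -/

lemma Diag.powTensor_congr {T : (∀ i, X i) → K} {ρ ι ι' : Type*} [Fintype ι] [Fintype ι']
    [DecidableEq ι] [DecidableEq ι'] (h : Diag (powTensor T ι) ρ) (e : ι ≃ ι') :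
    Diag (powTensor T ι') ρ :=
  h.of_equiv (fun _ => e.arrowCongr (Equiv.refl _) |>.symm) fun a => by
    simp only [powTensor]
    exact (e.prod_comp fun j => T fun i => a i j).symm

lemma Diag.powTensor_sum {T : (∀ i, X i) → K} {ρ ι ι' : Type*} [Fintype ι] [Fintype ι']
    [DecidableEq ι] [DecidableEq ι'] (h : Diag (tensorProd (powTensor T ι) (powTensor T ι')) ρ) :
    Diag (powTensor T (ι ⊕ ι')) ρ :=
  h.of_equiv (fun _ => Equiv.sumArrowEquivProdArrow _ _ _) fun a => by
    simp [powTensor, tensorProd, Fintype.prod_sum_type]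

lemma diag_unit (hk : 0 < k) {T : (∀ i, X i) → K} (hT : T ≠ 0) : Diag T Unit := by
  classical
  obtain ⟨a, ha⟩ := Function.ne_iff.1 hT
  refine Diag.of_ne_zero hk (fun i _ => Pi.single (a i) 1) (fun _ => ?_)
    fun b hb => (hb fun i i' => rfl).elim
  rw [mform_single]
  exact ha

lemma Diag.powTensor_add {T : (∀ i, X i) → K} (hk : 0 < k) (hT : T ≠ 0) {ρ : Type*} {N : ℕ}
    (h : Diag (powTensor T (Fin N)) ρ) (M : ℕ) : Diag (powTensor T (Fin (N + M))) ρ :=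
  (((h.tprod (diag_unit hk (powTensor_ne_zero hT (Fin M)))).powTensor_sum).comap
    (g := fun c => (c, ())) fun _ _ h => congr_arg Prod.fst h).powTensor_congr finSumFinEquiv

lemma Diag.powTensor_mul {T : (∀ i, X i) → K} (hk : 0 < k) (hT : T ≠ 0) {N r : ℕ}
    (h : Diag (powTensor T (Fin N)) (Fin r)) (l : ℕ) :
    Diag (powTensor T (Fin (l * N))) (Fin (r ^ l)) := by
  induction l with
  | zero =>
    refine (diag_unit hk (powTensor_ne_zero hT _)).comap (g := fun _ => ()) fun a b _ => ?_
    have := a.isLt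
    have := b.isLt
    apply Fin.ext
    simp only [pow_zero] at *
    omega
  | succ l ih =>
    have h2 := (ih.tprod h).powTensor_sum.powTensor_congr
      (finSumFinEquiv.trans (finCongr (show l * N + N = (l + 1) * N by ring)))
    exact h2.comap (g := finProdFinEquiv.symm.trans (Equiv.refl _) ∘ finCongr (pow_succ r l))
      ((Equiv.injective _).comp (Equiv.injective _))

/-- A tensor whose slots are pairwise not separated has a power restricting to the unit tensor of
size two. -/
lemma diag_two {n : Fin k → ℕ} (hk : 2 ≤ k) {T : KTensor K n}
    (h : ∀ i j : Fin k, i ≠ j → ¬ Sep T {i} {j}) :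
    ∃ N : ℕ, Diag (powTensor T (Fin N)) (Fin 2) := by
  classical
  let o : Fin k := ⟨0, by omega⟩
  let ι := {i : Fin k // i ≠ o}
  -- With the other slots fixed, non-separation of `o` and `i` gives a bilinear form with a nonzero
  -- 2×2 minor `D`. Applying the inverse of that 2×2 matrix in slot `o` produces dual pairs of
  -- vectors.
  have hpair : ∀ i : ι, ∃ v : Fin 2 → ∀ j, Fin (n j) → K,
      (∀ s t, mform T (Function.update (v 0) o (v s o) |> fun z =>
        Function.update z i.1 (v t i.1)) = if s = t then 1 else 0) := by
    rintro ⟨i, hi⟩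
    have hs := h o i hi.symm
    simp only [Sep, not_forall] at hs
    obtain ⟨x, x', hs⟩ := hs
    let F : (Fin (n o) → K) → (Fin (n i) → K) → K := fun p q =>
      mform T (Function.update (Function.update x o p) i q)
    have hFa : ∀ p p' q, F (p + p') q = F p q + F p' q := by
      intro p p' q
      simp only [F, Function.update_comm hi.symm, MultilinearMap.map_update_add]
    have hFs : ∀ (c : K) p q, F (c • p) q = c * F p q := by
      intro c p q
      simp only [F, Function.update_comm hi.symm, MultilinearMap.map_update_smul, smul_eq_mul]
    let D := F (x o) (x i) * F (x' o) (x' i) - F (x' o) (x i) * F (x o) (x' i)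
    have hD : D ≠ 0 := by
      have e1 : F (x o) (x i) = mform T x := by simp [F]
      have e2 : F (x' o) (x' i) = mform T (Finset.piecewise ({o} ∪ {i}) x' x) := by
        rw [← piecewise_union, ← update_eq_piecewise, ← update_eq_piecewise]
      have e3 : F (x' o) (x i) = mform T (Finset.piecewise {o} x' x) := by
        rw [← update_eq_piecewise]
        simp only [F]
        rw [Function.update_eq_self_iff.2]
        simp [hi]
      have e4 : F (x o) (x' i) = mform T (Finset.piecewise {i} x' x) := by
        rw [← update_eq_piecewise]
        simp [F]
      simp only [D, e1, e2, e3, e4]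
      exact sub_ne_zero.2 hs
    let p : Fin 2 → Fin (n o) → K :=
      ![D⁻¹ • (F (x' o) (x' i) • x o + (-F (x o) (x' i)) • x' o),
        D⁻¹ • ((-F (x' o) (x i)) • x o + F (x o) (x i) • x' o)]
    let q : Fin 2 → Fin (n i) → K := ![x i, x' i]
    refine ⟨fun s => Function.update (Function.update x o (p s)) i (q s), fun s t => ?_⟩
    have : mform T (Function.update (Function.update (Function.update
        (Function.update x o (p 0)) i (q 0)) o (p s)) i (q t)) = F (p s) (q t) := by
      simp only [F]
      congr 1
      funext l
      rcases eq_or_ne l i with rfl | hl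
      · simp
      · rcases eq_or_ne l o with rfl | hl'
        · simp [hl]
        · simp [hl, hl']
    simp only [Function.update_self, Function.update_of_ne hi.symm]
    rw [this]
    fin_cases s <;> fin_cases t <;>
      simp only [p, q, Fin.mk_one, Fin.zero_eta, Fin.isValue, Matrix.cons_val_zero,
        Matrix.cons_val_one, hFs, hFa, if_true, if_false, one_ne_zero,
        zero_ne_one]
    · rw [inv_mul_eq_one₀ hD]; simp only [D]; ring
    · rw [mul_eq_zero]; right; ring
    · rw [mul_eq_zero]; right; ring
    · rw [inv_mul_eq_one₀ hD]; simp only [D]; ring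
  choose v hv using hpair
  refine ⟨Fintype.card ι, Diag.powTensor_congr (ι := ι) ?_ (Fintype.equivFin ι)⟩
  -- One copy of `T` is used for each slot `e ≠ o`. It tests whether the indices in the slots `o`
  -- and `e` agree, its other slots being frozen; together the tests force all indices to agree.
  let u : ∀ j : Fin k, Fin 2 → ι → Fin (n j) → K := fun j s e =>
    if j = o ∨ j = e.1 then v e s j else v e 0 j
  have key : ∀ b : Fin k → Fin 2, mform (powTensor T ι) (fun j a => ∏ e, u j (b j) e (a e)) =
      ∏ e : ι, if b o = b e.1 then 1 else 0 := by
    intro b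
    rw [mform_powTensor T fun j => u j (b j)]
    refine Finset.prod_congr rfl fun e _ => ?_
    rw [← hv e (b o) (b e.1)]
    congr 1
    funext j
    rcases eq_or_ne j e.1 with rfl | hj
    · simp [u]
    · rcases eq_or_ne j o with rfl | hj'
      · simp [u, hj]
      · simp [u, hj, hj']
  refine ⟨fun j s a => ∏ e, u j s e (a e), fun c => ?_, fun b hb => ?_⟩
  · rw [key fun _ => c]
    simp
  · rw [key b]
    have : ∃ e : ι, b o ≠ b e.1 := by
      by_contra! hc
      have hall : ∀ i, b i = b o := fun i => by
        by_cases hi : i = o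
        · rw [hi]
        · exact (hc ⟨i, hi⟩).symm
      exact hb fun i i' => by rw [hall i, hall i']
    obtain ⟨e, he⟩ := this
    exact Finset.prod_eq_zero (Finset.mem_univ e) (if_neg he)

end

/-! ### Kronecker powers -/

section

variable {K : Type*} [Field K] {k : ℕ} {n : Fin k → ℕ}

lemma exists_kronPow_equiv (T : KTensor K n) (N : ℕ) :
    ∃ e : ∀ i, Fin (n i ^ N) ≃ (Fin N → Fin (n i)),
      ∀ a, kronPow T N a = powTensor T (Fin N) fun i => e i (a i) := by
  induction N with
  | zero =>
    refine ⟨fun i => (finCongr (pow_zero (n i))).trans (Equiv.ofUnique _ _), fun a => ?_⟩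
    simp [kronPow, powTensor]
  | succ N ih =>
    obtain ⟨e, he⟩ := ih
    refine ⟨fun i => (finProdFinEquiv (m := n i ^ N) (n := n i)).symm.trans
      (((e i).prodCongr (Equiv.refl _)).trans ((Equiv.prodComm _ _).trans
        (Fin.snocEquiv fun _ => Fin (n i)))), fun a => ?_⟩
    simp only [kronPow, kron, he, powTensor, Fin.prod_univ_castSucc]
    change _ = (∏ j : Fin N, T fun i => Fin.snoc (α := fun _ => Fin (n i))
        (e i (finProdFinEquiv.symm (a i)).1) (finProdFinEquiv.symm (a i)).2 j.castSucc) *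
      T fun i => Fin.snoc (α := fun _ => Fin (n i))
        (e i (finProdFinEquiv.symm (a i)).1) (finProdFinEquiv.symm (a i)).2 (Fin.last N)
    simp only [Fin.snoc_castSucc, Fin.snoc_last]

lemma Diag.kronPow {T : KTensor K n} {N : ℕ} {ρ : Type*} (h : Diag (powTensor T (Fin N)) ρ) :
    Diag (kronPow T N) ρ := by
  obtain ⟨e, he⟩ := exists_kronPow_equiv T N
  exact h.of_equiv e he

lemma Diag.restrictsTo (hk : 0 < k) {T : KTensor K n} {r : ℕ} (h : Diag T (Fin r)) :
    RestrictsTo T (unitTensor K k r) := by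
  classical
  obtain ⟨B, h1, h0⟩ := h
  refine ⟨fun i => Matrix.of (B i), ?_⟩
  funext b
  have hb : applyMaps (fun i => Matrix.of (B i)) T b = mform T fun i => B i (b i) := by
    simp [applyMaps, mform_apply]
  rw [hb, unitTensor, Finset.sum_apply]
  by_cases hc : ∀ i i', b i = b i'
  · obtain ⟨c, rfl⟩ : ∃ c : Fin r, b = fun _ => c := ⟨b ⟨0, hk⟩, funext fun i => hc i _⟩
    rw [h1, Finset.sum_eq_single c]
    · simp
    · intro j _ hj
      exact Finset.prod_eq_zero (Finset.mem_univ ⟨0, hk⟩) (by simp [hj.symm])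
    · simp
  · rw [h0 b hc]
    refine (Finset.sum_eq_zero fun j _ => ?_).symm
    push Not at hc
    obtain ⟨i, i', hi⟩ := hc
    by_cases hij : b i = j
    · exact Finset.prod_eq_zero (Finset.mem_univ i') (by simp [← hij, hi.symm])
    · exact Finset.prod_eq_zero (Finset.mem_univ i) (by simp [hij])

lemma le_of_diag (hk : 0 < k) {f : (n : Fin k → ℕ) → KTensor K n → ℝ≥0}
    (hf : IsNormalizedMonotone f) {T : KTensor K n} {N r : ℕ}
    (h : Diag (powTensor T (Fin N)) (Fin r)) : (r : ℝ≥0) ≤ f _ (kronPow T N) := by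
  rw [← hf.unit r]
  exact hf.mono _ _ _ _ (h.kronPow.restrictsTo hk)

lemma one_le_kronPow (hk : 0 < k) {f : (n : Fin k → ℕ) → KTensor K n → ℝ≥0}
    (hf : IsNormalizedMonotone f) {T : KTensor K n} (hT : T ≠ 0) (N : ℕ) :
    1 ≤ f _ (kronPow T N) := by
  have h : Diag (powTensor T (Fin N)) (Fin 1) :=
    (diag_unit hk (powTensor_ne_zero hT _)).comap (g := fun _ => ())
      fun _ _ _ => Subsingleton.elim _ _
  simpa using le_of_diag hk hf h

lemma minors_of_rank_eq_one {m l : Type*} [Fintype l] {M : Matrix m l K} (h : M.rank = 1)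
    (r r' : m) (c c' : l) : M r c * M r' c' = M r c' * M r' c := by
  classical
  obtain ⟨v, -, hv⟩ := finrank_eq_one_iff'.1 h
  have hcol : ∀ c, ∃ g : K, ∀ r, M r c = g * v.1 r := by
    intro c
    obtain ⟨g, hg⟩ := hv ⟨M.mulVecLin (Pi.single c 1), LinearMap.mem_range_self _ _⟩
    refine ⟨g, fun r => ?_⟩
    have := congr_fun (congr_arg Subtype.val hg) r
    simpa using this.symm
  obtain ⟨g, hg⟩ := hcol c
  obtain ⟨g', hg'⟩ := hcol c'
  simp only [hg, hg']
  ring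

lemma rank_flattening_kronPow_eq_one {T : KTensor K n} (hT : T ≠ 0) {I : Finset (Fin k)}
    (h : (flattening T I).rank = 1) (N : ℕ) : (flattening (kronPow T N) I).rank = 1 := by
  have hm : ∀ a a' : ∀ i, Fin (n i),
      T a * T a' = T (I.piecewise a' a) * T (Iᶜ.piecewise a' a) := by
    intro a a'
    have := minors_of_rank_eq_one h (fun i => a i) (fun i => a' i) (fun i => a i) (fun i => a' i)
    simp only [flattening, Matrix.of_apply] at this
    rw [mul_comm (T (I.piecewise a' a))]
    convert this using 2 <;>
    · refine congr_arg T (funext fun i => ?_)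
      by_cases hi : i ∈ I <;> simp [hi]
  obtain ⟨e, he⟩ := exists_kronPow_equiv T N
  have h0 : kronPow T N ≠ 0 := by
    intro h0
    apply powTensor_ne_zero hT (Fin N)
    funext a
    have := he fun i => (e i).symm (a i)
    rw [h0] at this
    simpa using this.symm
  refine rank_flattening_eq_one h0 I fun a a' => ?_
  simp only [he, powTensor, ← Finset.prod_mul_distrib]
  refine Finset.prod_congr rfl fun j _ => ?_
  rw [hm]
  congr 2 <;>
  · funext i
    by_cases hi : i ∈ I <;> simp [hi]

end

/-! ### Local unique solvability -/

/-- A family `S` of maps `P → Fin k` with fibres of size `m`, seen as ordered partitions of `P`,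
such that blocks `i` of members `ψ i` of `S` form a partition of `P` only if all `ψ i` are equal
to that partition. -/
def IsLocalUSP {k : ℕ} {P : Type*} [Fintype P] (m : ℕ) (S : Finset (P → Fin k)) : Prop :=
  (∀ φ ∈ S, ∀ i, (Finset.univ.filter fun x => φ x = i).card = m) ∧
    ∀ ψ : Fin k → P → Fin k, (∀ i, ψ i ∈ S) →
      ∀ φ : P → Fin k, (∀ i x, φ x = i ↔ ψ i x = i) → ∀ i, ψ i = φ

/-- A copy `j` contributes the form with `y i` in exactly those slots `i` whose chosen block
contains `j`. If no block does, the factor is `F(x) = 0`. Since the block sizes add up to the number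
of copies, a nonzero value puts each copy in exactly one block, and local unique solvability
applies. On the diagonal every factor is nonzero by `hy`. -/
lemma diag_of_isLocalUSP {L : Type*} [Field L] {k : ℕ} {n : Fin k → ℕ} (hk : 0 < k)
    {T : KTensor L n} {x y : ∀ i, Fin (n i) → L} (hx : mform T x = 0)
    (hy : ∀ i, mform T (Function.update x i (y i)) ≠ 0) {P : Type*} [Fintype P] [DecidableEq P]
    {m : ℕ} (hP : Fintype.card P = k * m) {S : Finset (P → Fin k)} (hS : IsLocalUSP m S) :
    Diag (powTensor T P) S := by
  classical
  let v : ∀ i, S → P → Fin (n i) → L := fun i c j => if c.1 j = i then y i else x i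
  have key : ∀ b : Fin k → S, mform (powTensor T P) (fun i a => ∏ j, v i (b i) j (a j)) =
      ∏ j, mform T fun i => if (b i).1 j = i then y i else x i :=
    fun b => mform_powTensor T fun i => v i (b i)
  refine Diag.of_ne_zero hk (fun i c a => ∏ j, v i c j (a j)) (fun c => ?_) fun b hb => ?_
  · rw [key fun _ => c]
    refine Finset.prod_ne_zero_iff.2 fun j _ => ?_
    convert hy (c.1 j) using 2
    funext i
    rcases eq_or_ne i (c.1 j) with h | h
    · subst h
      simp
    · simp [h, h.symm]
  · rw [key b]
    by_contra hne
    have hex : ∀ j, 1 ≤ (Finset.univ.filter fun i => (b i).1 j = i).card := by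
      intro j
      rw [Nat.one_le_iff_ne_zero, Finset.card_ne_zero]
      by_contra hemp
      rw [Finset.not_nonempty_iff_eq_empty, Finset.filter_eq_empty_iff] at hemp
      refine hne (Finset.prod_eq_zero (Finset.mem_univ j) ?_)
      rw [← hx]
      congr 1
      funext i
      exact if_neg (hemp (Finset.mem_univ i))
    have hsum : ∑ j, (Finset.univ.filter fun i => (b i).1 j = i).card = ∑ _j : P, 1 := by
      simp only [Finset.card_filter]
      rw [Finset.sum_comm]
      simp only [← Finset.card_filter, fun i => hS.1 (b i).1 (b i).2 i]
      simp [hP]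
    have hone := (Finset.sum_eq_sum_iff_of_le fun j _ => hex j).1 hsum.symm
    have hφ : ∀ j, ∃ i, (Finset.univ.filter fun i => (b i).1 j = i) = {i} :=
      fun j => Finset.card_eq_one.1 (hone j (Finset.mem_univ j)).symm
    choose φ hφ using hφ
    have hall := hS.2 (fun i => (b i).1) (fun i => (b i).2) φ fun i j => by
      have := congr_arg (i ∈ ·) (hφ j)
      simp only [Finset.mem_filter, Finset.mem_univ, true_and, Finset.mem_singleton, eq_iff_iff]
        at this
      rw [this, eq_comm]
    exact hb fun i i' => Subtype.ext ((hall i).trans (hall i').symm)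

/-- There is a constant number of extra copies with which every local uniquely solvable puzzle
turns into a restriction of a power of `T` to a unit tensor. -/
lemma exists_diag_add {K : Type*} [Field K] {k : ℕ} {n : Fin k → ℕ} (hk : 2 ≤ k)
    {T : KTensor K n} (hT : T ≠ 0) (h1 : ¬ HasRankOneFlattening T) :
    ∃ M : ℕ, ∀ (m r : ℕ) (S : Finset (Fin (k * m) → Fin k)), IsLocalUSP m S →
      Diag (powTensor T (Fin (k * m + (M + r)))) (Fin S.card) := by
  obtain ⟨L, hL, x, y, hx, hy⟩ := exists_finite_extension_zero hk hT h1
  obtain ⟨N, hN⟩ := diag_two hk fun i j hij => not_sep hT h1 hij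
  let R := Fintype.card (Fin k → Fin (Module.finrank K L))
  refine ⟨R * N, fun m r S hS => ?_⟩
  -- `R` is the size `d ^ k` required for the descent, and `R` unit tensors of size two supply `2 ^
  -- R ≥ R`. The `r` further copies are padding, to reach every exponent later.
  have hR := ((hN.powTensor_mul (by omega) hT R).powTensor_add (by omega) hT r).comap
    (((Fin.castLE_injective (Nat.lt_two_pow_self (n := R)).le)).comp
      (Fintype.equivFin (Fin k → Fin (Module.finrank K L))).injective)
  have hD := diag_of_isLocalUSP (by omega) hx hy (Fintype.card_fin _) hS
  rw [← extend_powTensor] at hD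
  exact ((hD.tprod_of_extend (by omega) hR).powTensor_sum.powTensor_congr finSumFinEquiv).comap
    S.equivFin.symm.injective

/-! ### Counting ordered partitions -/

/-- The multinomial coefficient `(j * m)! / (m !) ^ j`. -/
def multi (m j : ℕ) : ℕ := ∏ s ∈ Finset.range j, ((s + 1) * m).choose m

lemma multi_mul (m j : ℕ) : multi m j * m.factorial ^ j = (j * m).factorial := by
  induction j with
  | zero => simp [multi]
  | succ j ih =>
    have h := Nat.choose_mul_factorial_mul_factorial (show m ≤ (j + 1) * m by nlinarith)
    rw [show (j + 1) * m - m = j * m by rw [add_mul, one_mul, Nat.add_sub_cancel]] at h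
    rw [← h, ← ih, multi, Finset.prod_range_succ, ← multi, pow_succ]
    ring

lemma multi_pos (m j : ℕ) : 0 < multi m j :=
  Finset.prod_pos fun s _ => Nat.choose_pos (by nlinarith)

lemma prod_range_pow_le {g : ℕ → ℕ} (hg : Monotone g) {s t : ℕ} (hst : s ≤ t) :
    (∏ j ∈ Finset.range s, g j) ^ t ≤ (∏ j ∈ Finset.range t, g j) ^ s := by
  induction t, hst using Nat.le_induction with
  | base => exact le_rfl
  | succ t hst ih =>
    rw [pow_succ, Finset.prod_range_succ, mul_pow]
    refine Nat.mul_le_mul ih ?_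
    calc ∏ j ∈ Finset.range s, g j ≤ ∏ _j ∈ Finset.range s, g t :=
          Finset.prod_le_prod' fun j hj => hg ((Finset.mem_range.1 hj).le.trans hst)
      _ = g t ^ s := by simp

/-- The `j`-th root of `multi m (j + 1)` increases with `j`, being a geometric mean of an initial
segment of an increasing sequence. So the largest `j` gives the decisive lower bound on the hash
field. -/
lemma multi_succ_pow_le (m : ℕ) {s t : ℕ} (hst : s ≤ t) :
    multi m (s + 1) ^ t ≤ multi m (t + 1) ^ s := by
  have h : ∀ j, multi m (j + 1) = ∏ s ∈ Finset.range j, ((s + 2) * m).choose m := by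
    intro j
    rw [multi, Finset.prod_range_succ']
    simp
  rw [h, h]
  exact prod_range_pow_le (fun a b hab => Nat.choose_le_choose m (by gcongr)) hst

section

variable {k : ℕ} {P : Type*} [Fintype P] [DecidableEq P]

/-- The ordered partitions of `P` into `k` blocks of size `m`. -/
def balanced (P : Type*) [Fintype P] [DecidableEq P] (k m : ℕ) : Finset (P → Fin k) :=
  Finset.univ.filter fun φ => ∀ i, (Finset.univ.filter fun x => φ x = i).card = m

lemma mem_balanced {m : ℕ} {φ : P → Fin k} :
    φ ∈ balanced P k m ↔ ∀ i, (Finset.univ.filter fun x => φ x = i).card = m := by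
  simp [balanced]

/-- These permutations form a coset of the stabilizer of `φ`, a product of `k` symmetric groups on
blocks of size `m`. -/
lemma card_perm_comp_eq {m : ℕ} {φ φ' : P → Fin k} (h : φ ∈ balanced P k m)
    (h' : φ' ∈ balanced P k m) :
    (Finset.univ.filter fun σ : Equiv.Perm P => φ ∘ σ = φ').card = m.factorial ^ k := by
  rw [mem_balanced] at h h'
  have e : ∀ i, Nonempty ({a // φ' a = i} ≃ {a // φ a = i}) := fun i => by
    rw [← Fintype.card_eq, Fintype.card_subtype, Fintype.card_subtype, h, h']
  let τ : Equiv.Perm P := Equiv.ofFiberEquiv fun i => (e i).some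
  have hτ : ∀ a, φ (τ a) = φ' a := fun a => Equiv.ofFiberEquiv_map _ a
  have hst := DomMulAct.stabilizer_card φ
  simp only [Fintype.card_subtype, h, Finset.prod_const, Finset.card_univ, Fintype.card_fin] at hst
  rw [← hst]
  refine Finset.card_bij (fun σ _ => τ.symm.trans σ) (fun σ hσ => ?_) (fun σ _ σ' _ h => ?_)
    fun σ hσ => ⟨τ.trans σ, ?_, ?_⟩
  · simp only [Finset.mem_filter, Finset.mem_univ, true_and] at hσ ⊢
    funext a
    have := congr_fun hσ (τ.symm a)
    simp only [Function.comp_apply, Equiv.trans_apply] at this ⊢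
    rw [this, ← hτ, Equiv.apply_symm_apply]
  · ext a
    have := Equiv.congr_fun h (τ a)
    simpa using this
  · simp only [Finset.mem_filter, Finset.mem_univ, true_and] at hσ ⊢
    funext a
    have := congr_fun hσ (τ a)
    simp only [Function.comp_apply, Equiv.trans_apply] at this ⊢
    rw [this, hτ]
  · ext a
    simp

/-- Count the stabilizer of `κ ∘ φ` in two ways: as a product of symmetric groups on its fibres, and
by fibring it over the partitions `φ ∘ σ`, each reached `m! ^ k` times. -/
lemma card_balanced_comp_eq {m : ℕ} {φ : P → Fin k} (h : φ ∈ balanced P k m) {X : Type*}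
    [Fintype X] [DecidableEq X] (κ : Fin k → X) :
    ((balanced P k m).filter fun φ' => κ ∘ φ' = κ ∘ φ).card =
      ∏ v, multi m (Finset.univ.filter fun i => κ i = v).card := by
  have hfib : ∀ v, (Finset.univ.filter fun x => (κ ∘ φ) x = v).card =
      (Finset.univ.filter fun i => κ i = v).card * m := by
    intro v
    rw [Finset.card_eq_sum_card_fiberwise (f := φ) (t := Finset.univ.filter fun i => κ i = v)]
    · rw [Finset.sum_const_nat (m := m)]
      intro i hi
      rw [← mem_balanced.1 h i, Finset.filter_filter]
      congr 1
      ext x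
      simp only [Finset.mem_filter, Finset.mem_univ, true_and] at hi ⊢
      exact ⟨fun hx => hx.2, fun hx => ⟨by simp [hx, hi], hx⟩⟩
    · intro x hx
      simpa using hx
  have hH := DomMulAct.stabilizer_card (κ ∘ φ)
  simp only [Fintype.card_subtype, hfib, ← multi_mul, Finset.prod_mul_distrib,
    Finset.prod_pow_eq_pow_sum] at hH
  rw [← Finset.card_eq_sum_card_fiberwise (f := κ) (t := Finset.univ) (by simp), Finset.card_univ,
    Fintype.card_fin] at hH
  have hH2 : (Finset.univ.filter fun σ : Equiv.Perm P => (κ ∘ φ) ∘ σ = κ ∘ φ).card =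
      ((balanced P k m).filter fun φ' => κ ∘ φ' = κ ∘ φ).card * m.factorial ^ k := by
    rw [Finset.card_eq_sum_card_fiberwise (f := fun σ : Equiv.Perm P => φ ∘ σ)
      (t := (balanced P k m).filter fun φ' => κ ∘ φ' = κ ∘ φ)]
    · rw [Finset.sum_const_nat]
      intro φ' hφ'
      rw [Finset.mem_filter] at hφ'
      rw [← card_perm_comp_eq h hφ'.1, Finset.filter_filter]
      congr 1
      ext σ
      simp only [Finset.mem_filter, Finset.mem_univ, true_and]
      refine ⟨fun hx => hx.2, fun hx => ⟨?_, hx⟩⟩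
      rw [Function.comp_assoc, hx, hφ'.2]
    · intro σ hσ
      simp only [Finset.coe_filter, Finset.mem_univ, true_and, Set.mem_ofPred_eq,
        mem_balanced] at hσ ⊢
      refine ⟨fun i => ?_, by rw [← Function.comp_assoc, hσ]⟩
      rw [← mem_balanced.1 h i]
      refine Finset.card_bij (fun x _ => σ x) (by simp) (by simp) fun x hx => ⟨σ.symm x, ?_, ?_⟩
      · simpa using hx
      · simp
  rw [hH2] at hH
  exact Nat.eq_of_mul_eq_mul_right (pow_pos m.factorial_pos k) hH

lemma balanced_nonempty {m : ℕ} (hP : Fintype.card P = k * m) : (balanced P k m).Nonempty := by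
  have e : P ≃ Fin k × Fin m := Fintype.equivOfCardEq (by simp [hP])
  refine ⟨fun x => (e x).1, mem_balanced.2 fun i => ?_⟩
  have := Finset.card_bij (s := Finset.univ.filter fun x => (e x).1 = i)
    (t := (Finset.univ : Finset (Fin m))) (fun x _ => (e x).2) (by simp)
    (fun x hx y hy h => by
      simp only [Finset.mem_filter, Finset.mem_univ, true_and] at hx hy
      exact e.injective (Prod.ext (hx.trans hy.symm) h))
    fun j _ => ⟨e.symm (i, j), by simp, by simp⟩
  simpa using this

lemma card_balanced {m : ℕ} (hP : Fintype.card P = k * m) :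
    (balanced P k m).card = multi m k := by
  obtain ⟨φ, hφ⟩ := balanced_nonempty (P := P) hP
  have := card_balanced_comp_eq hφ fun _ => ()
  have he : (balanced P k m).filter (fun φ' => (fun _ => ()) ∘ φ' = (fun _ => ()) ∘ φ) =
      balanced P k m := Finset.filter_true_of_mem fun _ _ => rfl
  rw [he] at this
  simpa using this

/-! ### Hashing ordered partitions -/

/-- The sums of `u` over the blocks of an ordered partition. -/
def blockSum {F : Type*} [AddCommMonoid F] (φ : P → Fin k) (u : P → F) (i : Fin k) : F :=
  ∑ x with φ x = i, u x

variable {F : Type*} [Fintype F] [DecidableEq F]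

/-- The two sets are the kernels of a matrix and of its transpose, whose ranks agree. Thus the
collision probability of `φ` and `φ'` is governed by the functions on blocks that do not distinguish
them. -/
lemma card_blockSum_eq [Field F] (φ φ' : P → Fin k) :
    (Finset.univ.filter fun u : P → F => blockSum φ u = blockSum φ' u).card *
        Fintype.card F ^ k =
      (Finset.univ.filter fun l : Fin k → F => l ∘ φ' = l ∘ φ).card *
        Fintype.card F ^ Fintype.card P := by
  classical
  let A : Matrix (Fin k) P F := Matrix.of fun i x =>
    (if φ x = i then 1 else 0) - if φ' x = i then 1 else 0
  have h1 : ∀ u, u ∈ LinearMap.ker A.mulVecLin ↔ blockSum φ u = blockSum φ' u := by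
    intro u
    rw [LinearMap.mem_ker, ← sub_eq_zero (a := blockSum φ u)]
    have : A.mulVecLin u = blockSum φ u - blockSum φ' u := by
      funext i
      simp [A, blockSum, Matrix.mulVec, dotProduct, sub_mul, Finset.sum_filter]
    rw [this]
  have h2 : ∀ l, l ∈ LinearMap.ker A.transpose.mulVecLin ↔ l ∘ φ' = l ∘ φ := by
    intro l
    have : A.transpose.mulVecLin l = l ∘ φ - l ∘ φ' := by
      funext x
      simp [A, Matrix.vecMul, dotProduct, mul_sub]
    rw [LinearMap.mem_ker, this, sub_eq_zero, eq_comm]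
  have c1 : (Finset.univ.filter fun u : P → F => blockSum φ u = blockSum φ' u).card =
      Fintype.card F ^ Module.finrank F (LinearMap.ker A.mulVecLin) := by
    rw [← Nat.card_eq_fintype_card, ← Module.natCard_eq_pow_finrank, Nat.card_eq_fintype_card,
      ← Fintype.card_subtype]
    exact Fintype.card_congr (Equiv.subtypeEquivRight fun u => (h1 u).symm)
  have c2 : (Finset.univ.filter fun l : Fin k → F => l ∘ φ' = l ∘ φ).card =
      Fintype.card F ^ Module.finrank F (LinearMap.ker A.transpose.mulVecLin) := by
    rw [← Nat.card_eq_fintype_card, ← Module.natCard_eq_pow_finrank, Nat.card_eq_fintype_card,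
      ← Fintype.card_subtype]
    exact Fintype.card_congr (Equiv.subtypeEquivRight fun u => (h2 u).symm)
  have r1 := A.mulVecLin.finrank_range_add_finrank_ker
  have r2 := A.transpose.mulVecLin.finrank_range_add_finrank_ker
  have r3 := A.rank_transpose
  rw [Module.finrank_fintype_fun_eq_card] at r1 r2
  simp only [Fintype.card_fin] at r2
  rw [Matrix.rank, Matrix.rank] at r3
  rw [c1, c2, ← pow_add, ← pow_add]
  congr 1
  omega

/-- The fixed functions of a self-map of `Fin k` are determined by their values on its image. -/
lemma card_comp_self_le (c : Fin k → Fin k) :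
    (Finset.univ.filter fun l : Fin k → F => l ∘ c = l).card ≤
      Fintype.card F ^ (Finset.univ.image c).card := by
  rw [← Fintype.card_coe (Finset.univ.image c), ← Fintype.card_fun, ← Finset.card_univ]
  refine Finset.card_le_card_of_injOn (fun l x => l x.1) (by simp) ?_
  intro l hl l' hl' h
  simp only [Finset.coe_filter, Finset.mem_univ, true_and, Set.mem_ofPred_eq] at hl hl'
  funext j
  rw [← hl, ← hl']
  exact congr_fun h ⟨c j, by simp⟩

lemma exists_section {X : Type*} [DecidableEq X] (κ : Fin k → X) :
    ∃ c : Fin k → Fin k, κ ∘ c = κ ∧ (Finset.univ.image c).card = (Finset.univ.image κ).card := by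
  choose g hg using fun v : Set.range κ => v.2
  have h1 : κ ∘ (fun i => g ⟨κ i, i, rfl⟩) = κ := funext fun i => hg ⟨κ i, i, rfl⟩
  have hcg : ∀ i, g ⟨κ i, i, rfl⟩ = (fun i => g ⟨κ i, i, rfl⟩) i := fun _ => rfl
  refine ⟨fun i => g ⟨κ i, i, rfl⟩, h1, ?_⟩
  generalize hc : (fun i => g ⟨κ i, i, rfl⟩) = c at h1 hcg
  have hinj : Set.InjOn κ (Finset.univ.image c : Finset (Fin k)) := by
    intro a ha b hb hab
    simp only [Finset.coe_image, Finset.coe_univ, Set.image_univ, Set.mem_range] at ha hb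
    obtain ⟨i, rfl⟩ := ha
    obtain ⟨j, rfl⟩ := hb
    have hi := congr_fun h1 i
    have hj := congr_fun h1 j
    simp only [Function.comp_apply] at hi hj
    have : κ i = κ j := by rw [← hi, ← hj, hab]
    rw [← hcg, ← hcg]
    simp only [this]
  rw [← Finset.card_image_of_injOn hinj, Finset.image_image, h1]

/-- The function `l`, with a new value at `i`. -/
def separate (i : Fin k) (l : Fin k → F) : Fin k → Option F :=
  fun j => if j = i then none else some (l j)

/-- Each `l` is fixed by some `c : Fin k → Fin k` whose image has as many elements as `separate i l`
has values. There are at most `|F| ^ |im c|` functions fixed by a given `c`, and `k ^ k` maps `c`.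
-/
lemma sum_pow_separate_le (i : Fin k) :
    ∑ l : Fin k → F, Fintype.card F ^ (k - (Finset.univ.image (separate i l)).card) ≤
      k ^ k * Fintype.card F ^ k := by
  calc ∑ l : Fin k → F, Fintype.card F ^ (k - (Finset.univ.image (separate i l)).card)
      ≤ ∑ l : Fin k → F, ∑ c : Fin k → Fin k,
          if l ∘ c = l then Fintype.card F ^ (k - (Finset.univ.image c).card) else 0 := by
        refine Finset.sum_le_sum fun l _ => ?_
        obtain ⟨c, hc, hcard⟩ := exists_section (separate i l)
        have hlc : l ∘ c = l := by
          funext j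
          have := congr_fun hc j
          simp only [separate, Function.comp_apply] at this
          by_cases h1 : c j = i <;> by_cases h2 : j = i <;> simp_all
        rw [← hcard]
        have := Finset.single_le_sum (f := fun c : Fin k → Fin k =>
          if l ∘ c = l then Fintype.card F ^ (k - (Finset.univ.image c).card) else 0)
          (fun _ _ => Nat.zero_le _) (Finset.mem_univ c)
        simpa [hlc] using this
    _ = ∑ c : Fin k → Fin k, (Finset.univ.filter fun l : Fin k → F => l ∘ c = l).card *
          Fintype.card F ^ (k - (Finset.univ.image c).card) := by
        rw [Finset.sum_comm]
        refine Finset.sum_congr rfl fun c _ => ?_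
        rw [← Finset.sum_filter, Finset.sum_const, smul_eq_mul]
    _ ≤ ∑ _c : Fin k → Fin k, Fintype.card F ^ k := by
        refine Finset.sum_le_sum fun c _ => ?_
        refine (Nat.mul_le_mul_right _ (card_comp_self_le c)).trans_eq ?_
        rw [← pow_add, Nat.add_sub_of_le]
        simpa using Finset.card_le_univ (Finset.univ.image c)
    _ = k ^ k * Fintype.card F ^ k := by simp

/-- The count is at most a product of multinomials over the fibres of `separate i l`. Since `i` is
alone in its fibre, no other fibre has more than `k - 1` elements, so `hp` applies to each with `j`
one less than its size; these `j` add up to `k` minus the number of values. If `separate i l` is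
injective, no `φ' ≠ φ` is counted, and otherwise the exponent is positive, which leaves room for a
factor `C`. -/
lemma mul_card_separate_le {m C : ℕ}
    (hp : ∀ j, j + 2 ≤ k → C ^ j * multi m (j + 1) ≤ Fintype.card F ^ j) {φ : P → Fin k}
    (hφ : φ ∈ balanced P k m) (i : Fin k) (l : Fin k → F) :
    C * ((balanced P k m).filter fun φ' => φ' ≠ φ ∧
      separate i l ∘ φ' = separate i l ∘ φ).card ≤
        Fintype.card F ^ (k - (Finset.univ.image (separate i l)).card) := by
  by_cases hinj : Function.Injective (separate i l)
  · rw [Finset.card_eq_zero.2, mul_zero]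
    · exact Nat.zero_le _
    · rw [Finset.filter_eq_empty_iff]
      rintro φ' - ⟨hne, h⟩
      exact hne (hinj.comp_left h)
  have hlt : (Finset.univ.image (separate i l)).card < k := by
    have hle : (Finset.univ.image (separate i l)).card ≤ (Finset.univ : Finset (Fin k)).card :=
      Finset.card_image_le
    rw [Finset.card_fin] at hle
    refine lt_of_le_of_ne hle fun h => hinj ?_
    have := Finset.card_image_iff.1 (h.trans (Finset.card_fin k).symm)
    simpa using this
  have hcard : ((balanced P k m).filter fun φ' => φ' ≠ φ ∧
      separate i l ∘ φ' = separate i l ∘ φ).card ≤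
        ∏ v ∈ Finset.univ.image (separate i l),
          multi m (Finset.univ.filter fun j => separate i l j = v).card := by
    refine (Finset.card_le_card (Finset.monotone_filter_right _ fun φ' _ h => h.2)).trans ?_
    rw [card_balanced_comp_eq hφ (separate i l),
      ← Finset.prod_subset (Finset.subset_univ (Finset.univ.image (separate i l)))]
    intro v _ hv
    rw [Finset.card_eq_zero.2, multi]
    · simp
    · rw [Finset.filter_eq_empty_iff]
      intro j _ hj
      exact hv (Finset.mem_image.2 ⟨j, Finset.mem_univ j, hj⟩)
  have hpos : ∀ v ∈ Finset.univ.image (separate i l),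
      1 ≤ (Finset.univ.filter fun j => separate i l j = v).card := by
    intro v hv
    obtain ⟨j, -, hj⟩ := Finset.mem_image.1 hv
    exact Finset.card_pos.2 ⟨j, by simp [hj]⟩
  have hsum : ∑ v ∈ Finset.univ.image (separate i l),
      ((Finset.univ.filter fun j => separate i l j = v).card - 1) =
        k - (Finset.univ.image (separate i l)).card := by
    rw [Finset.sum_tsub_distrib _ hpos, ← Finset.card_eq_sum_card_image]
    simp
  calc C * _ ≤ C ^ (k - (Finset.univ.image (separate i l)).card) *
        ∏ v ∈ Finset.univ.image (separate i l),
          multi m (Finset.univ.filter fun j => separate i l j = v).card :=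
        Nat.mul_le_mul (Nat.le_self_pow (by omega) C) hcard
    _ = ∏ v ∈ Finset.univ.image (separate i l),
          (C ^ ((Finset.univ.filter fun j => separate i l j = v).card - 1) *
            multi m (Finset.univ.filter fun j => separate i l j = v).card) := by
        rw [Finset.prod_mul_distrib, Finset.prod_pow_eq_pow_sum, hsum]
    _ ≤ ∏ v ∈ Finset.univ.image (separate i l), Fintype.card F ^
          ((Finset.univ.filter fun j => separate i l j = v).card - 1) := by
        refine Finset.prod_le_prod' fun v hv => ?_
        have h1 := hpos v hv
        have h2 : (Finset.univ.filter fun j => separate i l j = v).card - 1 + 2 ≤ k ∨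
            (Finset.univ.filter fun j => separate i l j = v).card - 1 = 0 := by
          by_cases hvn : v = none
          · right
            have : (Finset.univ.filter fun j => separate i l j = v) = {i} := by
              ext j
              simp [hvn, separate]
            simp [this]
          · left
            have : (Finset.univ.filter fun j => separate i l j = v).card <
                (Finset.univ : Finset (Fin k)).card := by
              refine Finset.card_lt_univ_of_notMem (x := i) fun hi => hvn ?_
              rw [← (Finset.mem_filter.1 hi).2]
              simp [separate]
            rw [Finset.card_univ, Fintype.card_fin] at this
            omega
        obtain ⟨j, hj⟩ : ∃ j, (Finset.univ.filter fun j => separate i l j = v).card = j + 1 :=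
          ⟨_, (Nat.sub_add_cancel h1).symm⟩
        rw [hj, Nat.add_sub_cancel] at h2 ⊢
        rcases h2 with h2 | h2
        · exact hp j h2
        · subst h2
          simp [multi]
    _ = _ := by rw [Finset.prod_pow_eq_pow_sum, hsum]

/-- The partitions that share block `i` with `φ`, weighted by the number of functions on the set
of blocks that do not distinguish them from `φ`. -/
lemma mul_sum_card_sharing_le {m C : ℕ}
    (hp : ∀ j, j + 2 ≤ k → C ^ j * multi m (j + 1) ≤ Fintype.card F ^ j) {φ : P → Fin k}
    (hφ : φ ∈ balanced P k m) (i : Fin k) :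
    C * ∑ φ' ∈ (balanced P k m).filter (fun φ' => φ' ≠ φ ∧ ∀ x, φ' x = i ↔ φ x = i),
        (Finset.univ.filter fun l : Fin k → F => l ∘ φ' = l ∘ φ).card ≤
      k ^ k * Fintype.card F ^ k := by
  refine le_trans ?_ (sum_pow_separate_le i)
  rw [Finset.mul_sum]
  simp only [Finset.card_filter (fun l : Fin k → F => l ∘ _ = l ∘ φ), Finset.mul_sum]
  rw [Finset.sum_comm]
  refine Finset.sum_le_sum fun l _ => le_trans ?_ (mul_card_separate_le hp hφ i l)
  rw [← Finset.mul_sum, ← Finset.card_filter, Finset.filter_filter]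
  refine Nat.mul_le_mul_left _ (Finset.card_le_card (Finset.monotone_filter_right _ ?_))
  rintro φ' - ⟨⟨hne, hs⟩, hl⟩
  refine ⟨hne, funext fun x => ?_⟩
  have h1 := hs x
  have h2 := congr_fun hl x
  simp only [Function.comp_apply, separate] at h2 ⊢
  by_cases hx : φ x = i
  · simp [hx, h1.2 hx]
  · simp [hx, h1, h2]

end

/-! ### Local uniquely solvable puzzles from hashing -/

section

variable {K : ℕ} {P : Type*} [Fintype P] {F : Type*} [Field F]

/-- Only constant families in `B` have mean value in `B`. -/
def IsMeanFree (K : ℕ) (B : Finset F) : Prop :=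
  ∀ (x : Fin K → F) (y : F), (∀ i, x i ∈ B) → y ∈ B → ∑ i, x i = K * y → ∀ i, x i = y

lemma sum_blockSum {k : ℕ} (φ : P → Fin k) (u : P → F) : ∑ i, blockSum φ u i = ∑ x, u x :=
  Finset.sum_fiberwise _ _ _

lemma blockSum_congr {k : ℕ} {φ φ' : P → Fin k} {i : Fin k} (h : ∀ x, φ' x = i ↔ φ x = i)
    (u : P → F) : blockSum φ' u i = blockSum φ u i := by
  simp only [blockSum, h]

/-- The block sums add up to the constant `∑ x, u x`, so the last block alone determines `K` times
the common hash value. -/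
lemma mul_hash_eq {φ : P → Fin (K + 1)} {p : (P → F) × (Fin K → F)} {b : F}
    (h : ∀ i : Fin K, blockSum φ p.1 i.castSucc + p.2 i = b) :
    K * b = ∑ x, p.1 x - blockSum φ p.1 (Fin.last K) + ∑ i, p.2 i := by
  have h1 : ∑ i : Fin K, (blockSum φ p.1 i.castSucc + p.2 i) = K * b := by
    simp [h]
  rw [← h1, ← sum_blockSum φ p.1, Fin.sum_univ_castSucc, Finset.sum_add_distrib]
  ring

lemma card_shift [Fintype F] [DecidableEq F] (hK : 0 < K) (φ : P → Fin (K + 1)) (u : P → F) (B : Finset F) :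
    (Finset.univ.filter fun c : Fin K → F =>
      ∃ b ∈ B, ∀ i : Fin K, blockSum φ u i.castSucc + c i = b).card = B.card := by
  rw [← Finset.card_image_of_injective B
    (f := fun b (i : Fin K) => b - blockSum φ u i.castSucc)]
  · congr 1
    ext c
    simp only [Finset.mem_filter, Finset.mem_univ, true_and, Finset.mem_image]
    refine exists_congr fun b => and_congr_right fun _ => ?_
    rw [funext_iff]
    exact forall_congr' fun i => by rw [sub_eq_iff_eq_add', eq_comm]
  · intro b b' h
    simpa using congr_fun h ⟨0, hK⟩

variable [DecidableEq P] [DecidableEq F]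

/-- The ordered partitions for which the hash values of all but the last block agree and are
in `B`. -/
def survivors (B : Finset F) (m : ℕ) (p : (P → F) × (Fin K → F)) : Finset (P → Fin (K + 1)) :=
  (balanced P (K + 1) m).filter fun φ =>
    ∃ b ∈ B, ∀ i : Fin K, blockSum φ p.1 i.castSucc + p.2 i = b

/-- The pairs of different survivors that share a block. -/
def conflicts (B : Finset F) (m : ℕ) (p : (P → F) × (Fin K → F)) :
    Finset ((P → Fin (K + 1)) × (P → Fin (K + 1))) :=
  (survivors B m p ×ˢ survivors B m p).filter fun q =>
    q.2 ≠ q.1 ∧ ∃ i, ∀ x, q.2 x = i ↔ q.1 x = i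

/-- A shared block forces the same common hash value `b`: directly for one of the first `K` blocks,
through `K * b` for the last one. This `b` then determines all block sums. -/
lemma blockSum_eq_of_mem_conflicts (hK : (K : F) ≠ 0) {B : Finset F} {m : ℕ}
    {p : (P → F) × (Fin K → F)} {q : (P → Fin (K + 1)) × (P → Fin (K + 1))}
    (hq : q ∈ conflicts B m p) : blockSum q.1 p.1 = blockSum q.2 p.1 := by
  simp only [conflicts, survivors, Finset.mem_filter, Finset.mem_product] at hq
  obtain ⟨⟨⟨-, b, -, hb⟩, -, b', -, hb'⟩, -, i, hi⟩ := hq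
  have hbb : b = b' := by
    induction i using Fin.lastCases with
    | last =>
      apply mul_left_cancel₀ hK
      rw [mul_hash_eq hb, mul_hash_eq hb', blockSum_congr hi]
    | cast i => rw [← hb i, ← hb' i, blockSum_congr hi]
  subst hbb
  funext j
  induction j using Fin.lastCases with
  | last =>
    have := (mul_hash_eq hb).symm.trans (mul_hash_eq hb')
    linear_combination -this
  | cast j => exact add_right_cancel ((hb j).trans (hb' j).symm)

variable [Fintype F]

lemma sum_card_survivors (hK : 0 < K) (B : Finset F) (m : ℕ) :
    ∑ p : (P → F) × (Fin K → F), (survivors B m p).card =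
      (balanced P (K + 1) m).card * (Fintype.card F ^ Fintype.card P * B.card) := by
  simp only [survivors, Finset.card_filter]
  rw [Finset.sum_comm, Finset.sum_const_nat]
  intro φ _
  rw [Fintype.sum_prod_type, Finset.sum_const_nat (m := B.card)]
  · simp
  · intro u _
    rw [← Finset.card_filter]
    exact card_shift hK φ u B

/-- On average, conflicts number at most half the survivors. In the constant `2 * (K + 1) ^ (K +
2)`, a factor `(K + 1) ^ (K + 1)` absorbs the bound in `mul_sum_card_sharing_le`, another `K + 1`
the choice of the shared block, and 2 gives the half. -/
lemma two_mul_sum_card_conflicts_le (hK0 : 0 < K) (hK : (K : F) ≠ 0) (B : Finset F) {m : ℕ}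
    (hp : ∀ j, j + 2 ≤ K + 1 →
      (2 * (K + 1) ^ (K + 2)) ^ j * multi m (j + 1) ≤ Fintype.card F ^ j) :
    2 * ∑ p : (P → F) × (Fin K → F), (conflicts B m p).card ≤
      (balanced P (K + 1) m).card * (Fintype.card F ^ Fintype.card P * B.card) := by
  classical
  let N : (P → Fin (K + 1)) → (P → Fin (K + 1)) → ℕ := fun φ φ' =>
    (Finset.univ.filter fun u : P → F => blockSum φ u = blockSum φ' u).card
  let M : (P → Fin (K + 1)) → (P → Fin (K + 1)) → ℕ := fun φ φ' =>
    (Finset.univ.filter fun l : Fin (K + 1) → F => l ∘ φ' = l ∘ φ).card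
  let Q : (P → Fin (K + 1)) → Fin (K + 1) → Finset (P → Fin (K + 1)) := fun φ i =>
    (balanced P (K + 1) m).filter fun φ' => φ' ≠ φ ∧ ∀ x, φ' x = i ↔ φ x = i
  have h1 : ∑ p : (P → F) × (Fin K → F), (conflicts B m p).card ≤
      ∑ φ ∈ balanced P (K + 1) m, ∑ i, ∑ φ' ∈ Q φ i, N φ φ' * B.card := by
    calc ∑ p : (P → F) × (Fin K → F), (conflicts B m p).card
        ≤ ∑ p : (P → F) × (Fin K → F), ∑ φ ∈ balanced P (K + 1) m, ∑ i, ∑ φ' ∈ Q φ i,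
            if blockSum φ p.1 = blockSum φ' p.1 ∧ ∃ b ∈ B, ∀ i : Fin K,
              blockSum φ p.1 i.castSucc + p.2 i = b then 1 else 0 := by
          refine Finset.sum_le_sum fun p _ => ?_
          simp only [← Finset.card_filter, ← Finset.card_sigma]
          have hsub : conflicts B m p ⊆ ((balanced P (K + 1) m).sigma fun φ =>
              (Finset.univ : Finset (Fin (K + 1))).sigma fun i => (Q φ i).filter fun φ' =>
                blockSum φ p.1 = blockSum φ' p.1 ∧ ∃ b ∈ B, ∀ i : Fin K,
                  blockSum φ p.1 i.castSucc + p.2 i = b).image fun s => (s.1, s.2.2) := by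
            intro q hq
            have he := blockSum_eq_of_mem_conflicts hK hq
            simp only [conflicts, survivors, Finset.mem_filter, Finset.mem_product] at hq
            obtain ⟨⟨⟨hq1, hb⟩, hq2, -⟩, hne, i, hi⟩ := hq
            refine Finset.mem_image.2 ⟨⟨q.1, i, q.2⟩, ?_, rfl⟩
            simp only [Finset.mem_sigma, Finset.mem_univ, true_and, Finset.mem_filter, Q]
            exact ⟨hq1, ⟨hq2, hne, hi⟩, he, hb⟩
          exact (Finset.card_le_card hsub).trans Finset.card_image_le
      _ = ∑ φ ∈ balanced P (K + 1) m, ∑ i, ∑ φ' ∈ Q φ i, N φ φ' * B.card := by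
          rw [Finset.sum_comm]
          refine Finset.sum_congr rfl fun φ _ => ?_
          rw [Finset.sum_comm]
          refine Finset.sum_congr rfl fun i _ => ?_
          rw [Finset.sum_comm]
          refine Finset.sum_congr rfl fun φ' _ => ?_
          rw [Fintype.sum_prod_type]
          simp only [N, Finset.card_filter, Finset.sum_mul]
          refine Finset.sum_congr rfl fun u _ => ?_
          by_cases hu : blockSum φ u = blockSum φ' u
          · simp only [hu, true_and, if_true, one_mul]
            rw [← Finset.card_filter]
            exact card_shift hK0 φ' u B
          · simp [hu]
  have h2 : ∀ φ ∈ balanced P (K + 1) m, ∀ i,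
      2 * (K + 1) ^ (K + 2) * ∑ φ' ∈ Q φ i, M φ φ' ≤
        (K + 1) ^ (K + 1) * Fintype.card F ^ (K + 1) :=
    fun φ hφ i => mul_sum_card_sharing_le hp hφ i
  have h3 : ∀ φ ∈ balanced P (K + 1) m,
      2 * ∑ i, ∑ φ' ∈ Q φ i, N φ φ' ≤ Fintype.card F ^ Fintype.card P := by
    intro φ hφ
    have hpos : 0 < (K + 1) ^ (K + 2) * Fintype.card F ^ (K + 1) := by positivity
    refine Nat.le_of_mul_le_mul_left ?_ hpos
    calc (K + 1) ^ (K + 2) * Fintype.card F ^ (K + 1) * (2 * ∑ i, ∑ φ' ∈ Q φ i, N φ φ')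
        = 2 * (K + 1) ^ (K + 2) * ∑ i, ∑ φ' ∈ Q φ i, N φ φ' * Fintype.card F ^ (K + 1) := by
          simp only [← Finset.sum_mul]
          ring
      _ = ∑ i, (2 * (K + 1) ^ (K + 2) * ∑ φ' ∈ Q φ i, M φ φ') * Fintype.card F ^ Fintype.card P := by
          simp only [N, card_blockSum_eq, ← Finset.sum_mul, ← Finset.mul_sum, M]
          ring
      _ ≤ ∑ _i : Fin (K + 1), ((K + 1) ^ (K + 1) * Fintype.card F ^ (K + 1)) *
            Fintype.card F ^ Fintype.card P :=
          Finset.sum_le_sum fun i _ => Nat.mul_le_mul_right _ (h2 φ hφ i)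
      _ = _ := by
          simp
          ring
  calc 2 * ∑ p : (P → F) × (Fin K → F), (conflicts B m p).card
      ≤ 2 * ∑ φ ∈ balanced P (K + 1) m, ∑ i, ∑ φ' ∈ Q φ i, N φ φ' * B.card :=
        Nat.mul_le_mul_left _ h1
    _ = ∑ φ ∈ balanced P (K + 1) m, (2 * ∑ i, ∑ φ' ∈ Q φ i, N φ φ') * B.card := by
        simp only [← Finset.sum_mul, ← Finset.mul_sum]
        ring
    _ ≤ ∑ φ ∈ balanced P (K + 1) m, Fintype.card F ^ Fintype.card P * B.card :=
        Finset.sum_le_sum fun φ hφ => Nat.mul_le_mul_right _ (h3 φ hφ)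
    _ = _ := by simp

/-- Choose the hash by averaging survivors minus conflicts, then discard every survivor that shares
a block with another one. A partition glued from blocks of the rest is itself a survivor, as `B` is
mean-free; sharing a block with each of its sources, it equals all of them. -/
theorem exists_isLocalUSP_of_isMeanFree (hK0 : 0 < K) (hK : (K : F) ≠ 0) {B : Finset F}
    (hB : IsMeanFree K B) {m : ℕ}
    (hp : ∀ j, j + 2 ≤ K + 1 →
      (2 * (K + 1) ^ (K + 2)) ^ j * multi m (j + 1) ≤ Fintype.card F ^ j) :
    ∃ S : Finset (P → Fin (K + 1)), IsLocalUSP m S ∧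
      (balanced P (K + 1) m).card * B.card ≤ 2 * Fintype.card F ^ K * S.card := by
  classical
  obtain ⟨p, hpp⟩ : ∃ p : (P → F) × (Fin K → F),
      (balanced P (K + 1) m).card * B.card + 2 * Fintype.card F ^ K * (conflicts B m p).card ≤
        2 * Fintype.card F ^ K * (survivors B m p).card := by
    by_contra! hlt
    have h1 := Finset.sum_lt_sum_of_nonempty
      (s := (Finset.univ : Finset ((P → F) × (Fin K → F)))) Finset.univ_nonempty
      (fun p _ => hlt p)
    rw [← Finset.mul_sum, sum_card_survivors hK0, Finset.sum_add_distrib, ← Finset.mul_sum] at h1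
    have h2 := two_mul_sum_card_conflicts_le (P := P) hK0 hK B hp
    simp only [Finset.sum_const, Finset.card_univ, Fintype.card_prod, Fintype.card_fun,
      Fintype.card_fin, smul_eq_mul, ← Finset.mul_sum] at h1
    nlinarith [Nat.mul_le_mul_left (Fintype.card F ^ K) h2]
  let S := (survivors B m p).filter fun φ =>
    ∀ φ' ∈ survivors B m p, (∃ i, ∀ x, φ' x = i ↔ φ x = i) → φ' = φ
  refine ⟨S, ⟨fun φ hφ => ?_, fun ψ hψ φ hφ => ?_⟩, ?_⟩
  · exact mem_balanced.1 (Finset.mem_filter.1 (Finset.mem_filter.1 hφ).1).1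
  · have hs : ∀ i, ψ i ∈ survivors B m p := fun i => (Finset.mem_filter.1 (hψ i)).1
    have hbl : ∀ i, blockSum φ p.1 i = blockSum (ψ i) p.1 i := fun i => blockSum_congr (hφ i) p.1
    have hmem : φ ∈ survivors B m p := by
      choose b hbB hb using fun i => (Finset.mem_filter.1 (hs i)).2
      refine Finset.mem_filter.2 ⟨mem_balanced.2 fun i => ?_, b (Fin.last K), hbB _, fun i => ?_⟩
      · simp only [hφ i]
        exact mem_balanced.1 (Finset.mem_filter.1 (hs i)).1 i
      -- The first `K` hashes of the glued partition lie in `B`, and its last block fixes their sum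
      -- as `K` times an element of `B`.
      · refine hB (fun i => blockSum φ p.1 i.castSucc + p.2 i) (b (Fin.last K)) (fun i => ?_)
          (hbB _) ?_ i
        · simp only [hbl, hb, hbB]
        · rw [mul_hash_eq (hb (Fin.last K)), ← hbl, ← sum_blockSum φ p.1, Fin.sum_univ_castSucc,
            Finset.sum_add_distrib]
          ring
    exact fun i => ((Finset.mem_filter.1 (hψ i)).2 φ hmem ⟨i, hφ i⟩).symm
  · have hcard : (survivors B m p).card ≤ S.card + (conflicts B m p).card := by
      rw [← Finset.card_filter_add_card_filter_not (s := survivors B m p)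
        fun φ => ∀ φ' ∈ survivors B m p, (∃ i, ∀ x, φ' x = i ↔ φ x = i) → φ' = φ]
      refine Nat.add_le_add_left ?_ _
      refine le_trans (Finset.card_le_card ?_) (Finset.card_image_le (f := Prod.fst))
      intro φ hφ
      rw [Finset.mem_filter] at hφ
      obtain ⟨hφ, h⟩ := hφ
      push Not at h
      obtain ⟨φ', h1, h2, h3⟩ := h
      exact Finset.mem_image.2 ⟨(φ, φ'), Finset.mem_filter.2
        ⟨Finset.mem_product.2 ⟨hφ, h1⟩, h3, h2⟩, rfl⟩
    nlinarith [Nat.mul_le_mul_left (2 * Fintype.card F ^ K) hcard]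

end

/-! ### Large sets without nontrivial means -/

/-- Behrend's construction: digit vectors in `{0, …, t - 1} ^ D` on one sphere. As `K * t ≤ q`, sums
of `K` digits do not wrap around modulo `q`, and by strict convexity a mean of points on a sphere
lies on it only if they all coincide. The sphere is the most popular among at most `D * t ^ 2 + 1`
radii. -/
theorem exists_isMeanFree {K q D t : ℕ} (hq : q.Prime) (hK : 0 < K) (hKq : K < q) (hD : D ≠ 0)
    (ht : K * t ≤ q) :
    ∃ (F : Type) (_ : Field F) (_ : Fintype F) (_ : DecidableEq F) (B : Finset F),
      Fintype.card F = q ^ D ∧ (K : F) ≠ 0 ∧ IsMeanFree K B ∧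
        t ^ D ≤ (D * t ^ 2 + 1) * B.card := by
  classical
  have := Fact.mk hq
  let _ : Fintype (GaloisField q D) := Fintype.ofFinite _
  let e : GaloisField q D ≃ₗ[ZMod q] (Fin D → ZMod q) :=
    (Module.finBasisOfFinrankEq (ZMod q) (GaloisField q D) (GaloisField.finrank q hD)).equivFun
  let g : (Fin D → Fin t) → GaloisField q D := fun v => e.symm fun d => ((v d : ℕ) : ZMod q)
  have htq : t ≤ q := le_trans (Nat.le_mul_of_pos_left t hK) ht
  have hcast : ∀ a b : ℕ, a < q → b < q → ((a : ZMod q) = b) → a = b := fun a b ha hb h => by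
    have := (ZMod.natCast_eq_natCast_iff' a b q).1 h
    rwa [Nat.mod_eq_of_lt ha, Nat.mod_eq_of_lt hb] at this
  have hg : Function.Injective g := by
    intro v w h
    funext d
    have := congr_fun (e.symm.injective h) d
    exact Fin.ext (hcast _ _ ((v d).2.trans_le htq) ((w d).2.trans_le htq) this)
  let ρ : (Fin D → Fin t) → ℕ := fun v => ∑ d, (v d : ℕ) ^ 2
  have hρ : ∀ v ∈ (Finset.univ : Finset (Fin D → Fin t)), ρ v ∈ Finset.range (D * t ^ 2 + 1) := by
    intro v _
    rw [Finset.mem_range, Nat.lt_succ_iff]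
    calc ρ v ≤ ∑ _d : Fin D, t ^ 2 :=
          Finset.sum_le_sum fun d _ => Nat.pow_le_pow_left (v d).2.le 2
      _ = D * t ^ 2 := by simp
  obtain ⟨γ, hγ⟩ : ∃ γ, t ^ D ≤ (D * t ^ 2 + 1) * (Finset.univ.filter fun v => ρ v = γ).card := by
    by_contra! hlt
    have h1 := Finset.card_eq_sum_card_fiberwise (f := ρ) (t := Finset.range (D * t ^ 2 + 1)) hρ
    have h2 : (D * t ^ 2 + 1) * t ^ D < (D * t ^ 2 + 1) * t ^ D := by
      calc (D * t ^ 2 + 1) * t ^ D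
          = ∑ γ ∈ Finset.range (D * t ^ 2 + 1),
              (D * t ^ 2 + 1) * (Finset.univ.filter fun v => ρ v = γ).card := by
            rw [← Finset.mul_sum, ← h1]
            simp
        _ < ∑ _γ ∈ Finset.range (D * t ^ 2 + 1), t ^ D :=
            Finset.sum_lt_sum_of_nonempty (by simp) fun γ _ => hlt γ
        _ = _ := by simp
    exact lt_irrefl _ h2
  refine ⟨GaloisField q D, inferInstance, inferInstance, inferInstance,
    (Finset.univ.filter fun v => ρ v = γ).image g, ?_, ?_, ?_, ?_⟩
  · rw [← Nat.card_eq_fintype_card, GaloisField.card q D hD]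
  · rw [Ne, CharP.cast_eq_zero_iff (GaloisField q D) q]
    exact Nat.not_dvd_of_pos_of_lt hK hKq
  · intro x y hx hy hsum
    choose v hv hvx using fun i => Finset.mem_image.1 (hx i)
    obtain ⟨w, hw, rfl⟩ := Finset.mem_image.1 hy
    simp only [Finset.mem_filter, Finset.mem_univ, true_and] at hv hw
    have hcoord : ∀ d, ∑ i, (v i d : ℕ) = K * (w d : ℕ) := by
      intro d
      have h1 := congr_fun (congr_arg e hsum) d
      have h2 : (K : GaloisField q D) * g w = K • g w := by simp
      rw [h2, map_nsmul, map_sum] at h1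
      simp only [← hvx, Finset.sum_apply, Pi.smul_apply, g,
        LinearEquiv.apply_symm_apply, nsmul_eq_mul] at h1
      have htpos : 0 < t := lt_of_le_of_lt (Nat.zero_le _) (w d).2
      have hKt : K * (t - 1) < q := lt_of_lt_of_le (Nat.mul_lt_mul_of_pos_left (by omega) hK) ht
      refine hcast _ _ (lt_of_le_of_lt ?_ hKt) (lt_of_le_of_lt ?_ hKt) (by push_cast; exact h1)
      · calc ∑ i, (v i d : ℕ) ≤ ∑ _i : Fin K, (t - 1) :=
              Finset.sum_le_sum fun i _ => Nat.le_sub_one_of_lt (v i d).2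
          _ = K * (t - 1) := by simp
      · exact Nat.mul_le_mul_left K (Nat.le_sub_one_of_lt (w d).2)
    have hzero : ∑ i, ∑ d, ((v i d : ℤ) - w d) ^ 2 = 0 := by
      have e1 : ∀ i, ∑ d, (v i d : ℤ) ^ 2 = γ := fun i => by exact_mod_cast hv i
      have e2 : ∑ d, (w d : ℤ) ^ 2 = γ := by exact_mod_cast hw
      have e3 : ∑ i, ∑ d, (v i d : ℤ) * w d = K * γ := by
        rw [Finset.sum_comm, ← e2, Finset.mul_sum]
        refine Finset.sum_congr rfl fun d _ => ?_
        rw [← Finset.sum_mul]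
        have : ∑ i, (v i d : ℤ) = K * w d := by exact_mod_cast hcoord d
        rw [this]
        ring
      have e4 : ∀ i, ∑ d, ((v i d : ℤ) - w d) ^ 2 = 2 * γ - 2 * ∑ d, (v i d : ℤ) * w d := by
        intro i
        rw [Finset.mul_sum, two_mul (γ : ℤ)]
        nth_rewrite 1 [← e1 i]
        rw [← e2, ← Finset.sum_add_distrib, ← Finset.sum_sub_distrib]
        exact Finset.sum_congr rfl fun d _ => by ring
      simp only [e4, Finset.sum_sub_distrib, ← Finset.mul_sum, e3]
      simp
    intro i
    rw [← hvx i]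
    congr 1
    funext d
    have h1 := (Finset.sum_eq_zero_iff_of_nonneg fun i _ =>
      Finset.sum_nonneg fun d _ => sq_nonneg _).1 hzero i (Finset.mem_univ i)
    have h2 := (Finset.sum_eq_zero_iff_of_nonneg fun d _ => sq_nonneg _).1 h1 d (Finset.mem_univ d)
    have h3 := sub_eq_zero.1 (pow_eq_zero_iff two_ne_zero |>.1 h2)
    exact Fin.ext (by exact_mod_cast h3)
  · rw [Finset.card_image_of_injective _ hg]
    exact hγ

/-! ### Asymptotic estimates -/

lemma one_lt_gapConst {k : ℕ} (hk : 2 ≤ k) : 1 < gapConst k := by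
  have hk' : (2 : ℝ) ≤ k := by exact_mod_cast hk
  have h1 : ((k : ℝ) - 1) ^ (((k : ℝ) - 1) / k) ≤ ((k : ℝ) - 1) ^ (1 : ℝ) :=
    Real.rpow_le_rpow_of_exponent_le (by linarith)
      ((div_le_one (by linarith)).2 (by linarith))
  rw [Real.rpow_one] at h1
  rw [gapConst, one_lt_div (Real.rpow_pos_of_pos (by linarith) _)]
  linarith

lemma gapConst_pow_mul {K : ℕ} (hK : 0 < K) (m : ℕ) :
    gapConst (K + 1) ^ ((K + 1) * m) * (K : ℝ) ^ (K * m) = ((K : ℝ) + 1) ^ ((K + 1) * m) := by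
  have hK' : (0 : ℝ) < K := by exact_mod_cast hK
  have h : (((K : ℝ)) ^ ((K : ℝ) / (K + 1))) ^ ((K + 1) * m) = (K : ℝ) ^ (K * m) := by
    rw [← Real.rpow_natCast, ← Real.rpow_mul hK'.le, ← Real.rpow_natCast]
    congr 1
    push_cast
    field_simp
  rw [gapConst]
  push_cast
  rw [add_sub_cancel_right, div_pow, h]
  field_simp

/-- The terms of the binomial expansion of `(1 + K) ^ ((K + 1) * m)` are largest at `m`. -/
lemma choose_mul_pow_le {K m j : ℕ} (hK : 0 < K) (hj : j ≤ (K + 1) * m) :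
    ((K + 1) * m).choose j * K ^ ((K + 1) * m - j) ≤ ((K + 1) * m).choose m * K ^ (K * m) := by
  set N := (K + 1) * m with hN
  have hNm : N - m = K * m := by rw [hN, add_mul, one_mul, Nat.add_sub_cancel]
  have hmN : m ≤ N := by rw [hN]; nlinarith
  let t : ℕ → ℕ := fun j => N.choose j * K ^ (N - j)
  have hstep : ∀ j, j < N → t (j + 1) * ((j + 1) * K) = t j * (N - j) := by
    intro j hj
    have h1 := Nat.choose_succ_right_eq N j
    have h2 : K ^ (N - j) = K ^ (N - (j + 1)) * K := by
      rw [← pow_succ]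
      congr 1
      omega
    simp only [t, h2]
    linear_combination (K ^ (N - (j + 1)) * K) * h1
  have hup : ∀ d, ∀ j, j + d = m → t j ≤ t m := by
    intro d
    induction d with
    | zero => rintro j rfl; exact le_rfl
    | succ d ih =>
      intro j hj
      refine le_trans ?_ (ih (j + 1) (by omega))
      have hjN : j < N := by omega
      have hle : (j + 1) * K ≤ N - j := by
        have : (j + 1) * K ≤ m * K := Nat.mul_le_mul_right K (by omega)
        have : N = m * K + m := by rw [hN]; ring
        omega
      refine Nat.le_of_mul_le_mul_right ?_ (show 0 < N - j by omega)
      rw [← hstep j hjN]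
      exact Nat.mul_le_mul_left _ hle
  have hdown : ∀ d, m + d ≤ N → t (m + d) ≤ t m := by
    intro d
    induction d with
    | zero => intro _; exact le_rfl
    | succ d ih =>
      intro hd
      refine le_trans ?_ (ih (by omega))
      have hle : N - (m + d) ≤ (m + d + 1) * K := by
        have : m * K ≤ (m + d + 1) * K := Nat.mul_le_mul_right K (by omega)
        have : N = m * K + m := by rw [hN]; ring
        omega
      refine Nat.le_of_mul_le_mul_right ?_ (show 0 < (m + d + 1) * K by positivity)
      rw [← add_assoc, hstep (m + d) (by omega)]
      exact Nat.mul_le_mul_left _ hle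
  have hall : t j ≤ t m := by
    rcases le_total j m with h | h
    · exact hup (m - j) j (by omega)
    · obtain ⟨d, rfl⟩ := Nat.exists_eq_add_of_le h
      exact hdown d hj
  simpa only [t, hNm] using hall

/-- `(K + 1) ^ ((K + 1) * m)` is a binomial sum whose number of terms is the first factor and whose
largest term is the one at `m`. -/
lemma gapConst_pow_le {K : ℕ} (hK : 0 < K) (m : ℕ) :
    gapConst (K + 1) ^ ((K + 1) * m) ≤
      ((((K + 1) * m + 1) * ((K + 1) * m).choose m : ℕ) : ℝ) := by
  have h1 : (K + 1) ^ ((K + 1) * m) ≤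
      ((K + 1) * m + 1) * (((K + 1) * m).choose m * K ^ (K * m)) := by
    rw [add_comm K 1, add_pow, add_comm 1 K]
    calc _ ≤ ∑ _j ∈ Finset.range ((K + 1) * m + 1), ((K + 1) * m).choose m * K ^ (K * m) := by
          refine Finset.sum_le_sum fun j hj => ?_
          rw [one_pow, one_mul, mul_comm]
          exact choose_mul_pow_le hK (Nat.lt_succ_iff.1 (Finset.mem_range.1 hj))
      _ = _ := by simp
  have hpos : (0 : ℝ) < (K : ℝ) ^ (K * m) := by positivity
  refine le_of_mul_le_mul_right ?_ hpos
  rw [gapConst_pow_mul hK]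
  calc ((K : ℝ) + 1) ^ ((K + 1) * m) = (((K + 1) ^ ((K + 1) * m) : ℕ) : ℝ) := by push_cast; rfl
    _ ≤ ((((K + 1) * m + 1) * (((K + 1) * m).choose m * K ^ (K * m)) : ℕ) : ℝ) := by
        exact_mod_cast h1
    _ = _ := by push_cast; ring

lemma multi_le_two_pow (m K : ℕ) : multi m K ≤ 2 ^ (K * (K * m)) := by
  calc multi m K ≤ ∏ _s ∈ Finset.range K, 2 ^ (K * m) := by
        refine Finset.prod_le_prod' fun s hs => (Nat.choose_le_two_pow _ _).trans ?_
        exact Nat.pow_le_pow_right (by norm_num)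
          (Nat.mul_le_mul_right m (Finset.mem_range.1 hs))
    _ = _ := by rw [Finset.prod_const, Finset.card_range, ← pow_mul, mul_comm]

/-- A power of `q` that is large enough for hashing ordered partitions, but not much larger. -/
lemma exists_hash_size {K q C : ℕ} (hK : 0 < K) (hq : 2 ≤ q) (hC : 0 < C) (m : ℕ) :
    ∃ D, D ≠ 0 ∧ (∀ j, j + 2 ≤ K + 1 → C ^ j * multi m (j + 1) ≤ (q ^ D) ^ j) ∧
      (q ^ D) ^ (K - 1) ≤ (q * C) ^ (K - 1) * multi m K ∧
      q ^ D ≤ q * C ^ (K - 1) * multi m K := by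
  obtain ⟨L, rfl⟩ : ∃ L, K = L + 1 := ⟨K - 1, by omega⟩
  simp only [Nat.add_sub_cancel]
  have hm := multi_pos m (L + 1)
  have hq0 : 0 < q := by omega
  -- For `L = 0` only `j = 0` is constrained and the exponents `L` give no information, so `D = 1`
  -- is taken by hand.
  rcases Nat.eq_zero_or_pos L with rfl | hL
  · refine ⟨1, one_ne_zero, fun j hj => ?_, ?_, ?_⟩
    · obtain rfl : j = 0 := by omega
      simp [multi]
    · simp [multi]
    · simp [multi]
  -- The least such exponent is used; minimality bounds it from above up to a factor `q`.
  have hex : ∃ D, C ^ L * multi m (L + 1) ≤ (q ^ (D + 1)) ^ L := by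
    refine ⟨C ^ L * multi m (L + 1), ?_⟩
    calc C ^ L * multi m (L + 1) ≤ C ^ L * multi m (L + 1) + 1 := Nat.le_succ _
      _ ≤ q ^ (C ^ L * multi m (L + 1) + 1) := (Nat.lt_pow_self hq).le
      _ ≤ _ := Nat.le_self_pow hL.ne' _
  classical
  have hD := Nat.find_spec hex
  have hmin : ∀ d, d < Nat.find hex → (q ^ (d + 1)) ^ L < C ^ L * multi m (L + 1) :=
    fun d hd => not_le.1 (Nat.find_min hex hd)
  set d := Nat.find hex
  have hprev : (q ^ d) ^ L ≤ C ^ L * multi m (L + 1) := by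
    rcases Nat.eq_zero_or_pos d with h0 | h0
    · rw [h0, pow_zero, one_pow]
      exact Nat.mul_pos (pow_pos hC L) hm
    · have := hmin (d - 1) (by omega)
      rw [Nat.sub_add_cancel h0] at this
      exact this.le
  refine ⟨d + 1, Nat.succ_ne_zero d, fun j hj => ?_, ?_, ?_⟩
  · have hjL : j ≤ L := by omega
    refine (Nat.pow_le_pow_iff_left hL.ne').1 ?_
    calc (C ^ j * multi m (j + 1)) ^ L = (C ^ L) ^ j * multi m (j + 1) ^ L := by
          rw [mul_pow, ← pow_mul, ← pow_mul, mul_comm j L]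
      _ ≤ (C ^ L) ^ j * multi m (L + 1) ^ j := Nat.mul_le_mul_left _ (multi_succ_pow_le m hjL)
      _ = (C ^ L * multi m (L + 1)) ^ j := (mul_pow _ _ _).symm
      _ ≤ ((q ^ (d + 1)) ^ L) ^ j := Nat.pow_le_pow_left hD j
      _ = ((q ^ (d + 1)) ^ j) ^ L := pow_right_comm _ _ _
  · calc (q ^ (d + 1)) ^ L = q ^ L * (q ^ d) ^ L := by rw [pow_succ, mul_pow, mul_comm]
      _ ≤ q ^ L * (C ^ L * multi m (L + 1)) := Nat.mul_le_mul_left _ hprev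
      _ = _ := by rw [mul_pow, mul_assoc]
  · calc q ^ (d + 1) = q * q ^ d := by rw [pow_succ, mul_comm]
      _ ≤ q * (q ^ d) ^ L := Nat.mul_le_mul_left _ (Nat.le_self_pow hL.ne' _)
      _ ≤ q * (C ^ L * multi m (L + 1)) := Nat.mul_le_mul_left _ hprev
      _ = _ := by rw [mul_assoc]

/-- The size of a local uniquely solvable puzzle is a binomial coefficient up to a constant factor
and a factor that is subexponential when `q` is large. -/
lemma exists_isLocalUSP_choose_le {K q : ℕ} (hK : 0 < K) (hq : q.Prime) (hKq : K < q) :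
    ∃ A A' : ℕ, 0 < A ∧ 0 < A' ∧ ∀ m, ∃ (D : ℕ) (S : Finset (Fin ((K + 1) * m) → Fin (K + 1))),
      IsLocalUSP m S ∧ ((K + 1) * m).choose m ≤ A * (4 * K) ^ D * S.card ∧
        q ^ D ≤ A' * 2 ^ (K * (K * m)) := by
  set C := 2 * (K + 1) ^ (K + 2) with hC
  have hC0 : 0 < C := by positivity
  have hq0 := hq.pos
  refine ⟨2 * (q * C) ^ (K - 1) * q ^ 2, q * C ^ (K - 1), by positivity, by positivity,
    fun m => ?_⟩
  obtain ⟨D, hD0, hD1, hD2, hD3⟩ := exists_hash_size hK hq.two_le hC0 m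
  -- The largest digit range without wrap-around. Since `q ≤ 2 * K * t`, passing from `q ^ D` to `t
  -- ^ D` costs `(2 * K) ^ D`, and the number of radii another `2 ^ D` up to a constant.
  set t := q / K with ht
  have htq : K * t ≤ q := Nat.mul_div_le q K
  have ht0 : 0 < t := Nat.div_pos hKq.le hK
  have hqt : q ≤ 2 * K * t := by
    have := Nat.lt_mul_div_succ q hK
    rw [← ht] at this
    nlinarith
  have htq' : t ≤ q := Nat.div_le_self q K
  obtain ⟨F, _, _, _, B, hF, hKF, hB, hBcard⟩ := exists_isMeanFree hq hK hKq hD0 htq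
  obtain ⟨S, hS, hcard⟩ := exists_isLocalUSP_of_isMeanFree (P := Fin ((K + 1) * m)) hK hKF hB
    (m := m) (by rw [hF]; exact hD1)
  refine ⟨D, S, hS, ?_, hD3.trans (Nat.mul_le_mul_left _ (multi_le_two_pow m K))⟩
  rw [card_balanced (Fintype.card_fin _), hF] at hcard
  have hmulti : multi m (K + 1) = multi m K * ((K + 1) * m).choose m := by
    rw [multi, Finset.prod_range_succ, ← multi]
  have hm := multi_pos m K
  set c := ((K + 1) * m).choose m
  have h1 : c * B.card ≤ 2 * (q * C) ^ (K - 1) * q ^ D * S.card := by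
    refine Nat.le_of_mul_le_mul_left ?_ hm
    have hpow : (q ^ D) ^ K = q ^ D * (q ^ D) ^ (K - 1) := by
      rw [← pow_succ', Nat.sub_add_cancel hK]
    calc multi m K * (c * B.card) = multi m (K + 1) * B.card := by rw [hmulti]; ring
      _ ≤ 2 * (q ^ D) ^ K * S.card := hcard
      _ = 2 * q ^ D * S.card * (q ^ D) ^ (K - 1) := by rw [hpow]; ring
      _ ≤ 2 * q ^ D * S.card * ((q * C) ^ (K - 1) * multi m K) := Nat.mul_le_mul_left _ hD2
      _ = _ := by ring
  have h2 : D * t ^ 2 + 1 ≤ 2 ^ D * q ^ 2 := by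
    calc D * t ^ 2 + 1 ≤ D * t ^ 2 + t ^ 2 := Nat.add_le_add_left (Nat.one_le_pow _ _ ht0) _
      _ = (D + 1) * t ^ 2 := by ring
      _ ≤ 2 ^ D * q ^ 2 := Nat.mul_le_mul Nat.lt_two_pow_self (Nat.pow_le_pow_left htq' 2)
  refine Nat.le_of_mul_le_mul_right ?_ (pow_pos ht0 D)
  calc c * t ^ D ≤ c * ((D * t ^ 2 + 1) * B.card) := Nat.mul_le_mul_left _ hBcard
    _ = c * B.card * (D * t ^ 2 + 1) := by ring
    _ ≤ (2 * (q * C) ^ (K - 1) * q ^ D * S.card) * (2 ^ D * q ^ 2) := Nat.mul_le_mul h1 h2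
    _ ≤ (2 * (q * C) ^ (K - 1) * (2 * K * t) ^ D * S.card) * (2 ^ D * q ^ 2) := by gcongr
    _ = _ := by
        rw [show 4 * K = 2 * K * 2 by ring, mul_pow _ t, mul_pow _ 2]
        ring

theorem exists_isLocalUSP {k : ℕ} (hk : 2 ≤ k) {ε : ℝ} (hε : 0 < ε) :
    ∀ᶠ m : ℕ in Filter.atTop, ∃ S : Finset (Fin (k * m) → Fin k), IsLocalUSP m S ∧
      gapConst k ^ ((1 - ε) * (k * m : ℕ)) ≤ (S.card : ℝ) := by
  obtain ⟨K, rfl⟩ : ∃ K, k = K + 1 := ⟨k - 1, by omega⟩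
  have hK : 0 < K := by omega
  have hK' : (1 : ℝ) ≤ K := by exact_mod_cast hK
  have hc := one_lt_gapConst hk
  set c := gapConst (K + 1)
  have hlc : 0 < Real.log c := Real.log_pos hc
  have hl4 : 0 < Real.log (4 * K) := Real.log_pos (by linarith)
  set δ := ε * Real.log c with hδ
  have hδ0 : 0 < δ := mul_pos hε hlc
  -- As `D` is at most about `K ^ 2 * m * log 2 / log q`, a large fixed `q` makes the loss `(4 * K)
  -- ^ D` cost at most `δ / 2` per copy, up to a constant. The two remaining quarters of `δ` absorb
  -- the polynomial factor and the constants.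
  obtain ⟨q, hqge, hq⟩ := Nat.exists_infinite_primes
    (max (K + 1) ⌈Real.exp (2 * Real.log (4 * K) * K ^ 2 * Real.log 2 / δ)⌉₊)
  have hKq : K < q := by
    have := (le_max_left _ _).trans hqge
    omega
  have hlq : 2 * Real.log (4 * K) * K ^ 2 * Real.log 2 / δ ≤ Real.log q := by
    rw [Real.le_log_iff_exp_le (by exact_mod_cast hq.pos)]
    exact Nat.ceil_le.1 ((le_max_right _ _).trans hqge)
  have hlq0 : 0 < Real.log q := Real.log_pos (by exact_mod_cast hq.one_lt)
  obtain ⟨A, A', hA, hA', h⟩ := exists_isLocalUSP_choose_le hK hq hKq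
  have hA0 : (0 : ℝ) < A := by exact_mod_cast hA
  have hA0' : (0 : ℝ) < A' := by exact_mod_cast hA'
  set B := Real.log A + Real.log (4 * K) * Real.log A' / Real.log q with hB
  have hlim : Filter.Tendsto (fun m : ℕ => ((K + 1) * m : ℕ)) Filter.atTop Filter.atTop :=
    Filter.tendsto_id.const_mul_atTop' (by omega)
  have hlog : ∀ᶠ m : ℕ in Filter.atTop,
      Real.log ((((K + 1) * m : ℕ) : ℝ) + 1) ≤ δ / 4 * (((K + 1) * m : ℕ) : ℝ) := by
    have h1 := (Real.isLittleO_log_id_atTop.bound (show 0 < δ / 8 by positivity))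
    have h2 : Filter.Tendsto (fun m : ℕ => (((K + 1) * m : ℕ) : ℝ) + 1) Filter.atTop Filter.atTop :=
      Filter.tendsto_atTop_add_const_right _ _ (tendsto_natCast_atTop_atTop.comp hlim)
    filter_upwards [h2.eventually h1, Filter.eventually_ge_atTop 1] with m hm hm1
    have hN : (1 : ℝ) ≤ (((K + 1) * m : ℕ) : ℝ) := by
      exact_mod_cast Nat.mul_pos (Nat.succ_pos K) hm1
    simp only [id, Real.norm_eq_abs] at hm
    rw [abs_of_nonneg (by linarith : (0 : ℝ) ≤ (((K + 1) * m : ℕ) : ℝ) + 1)] at hm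
    nlinarith [le_abs_self (Real.log ((((K + 1) * m : ℕ) : ℝ) + 1))]
  have hconst : ∀ᶠ m : ℕ in Filter.atTop, B ≤ δ / 4 * (((K + 1) * m : ℕ) : ℝ) :=
    ((tendsto_natCast_atTop_atTop.comp hlim).const_mul_atTop
      (show 0 < δ / 4 by positivity)).eventually_ge_atTop B
  filter_upwards [hlog, hconst] with m hm1 hm2
  have hm := h m
  have hgap := gapConst_pow_le hK m
  set N := (K + 1) * m with hN
  obtain ⟨D, S, hS, hchoose, hD⟩ := hm
  refine ⟨S, hS, ?_⟩
  have hS0 : 0 < S.card := by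
    refine Nat.pos_of_ne_zero fun h0 => ?_
    rw [h0, mul_zero] at hchoose
    exact absurd hchoose (not_le.2 (Nat.choose_pos (by rw [hN]; nlinarith)))
  have hS0' : (0 : ℝ) < S.card := by exact_mod_cast hS0
  have e1 : (N : ℝ) * Real.log c ≤
      Real.log ((N : ℝ) + 1) + Real.log A + D * Real.log (4 * K) + Real.log S.card := by
    have hle : c ^ N ≤ ((N : ℝ) + 1) * ((A * (4 * K) ^ D) * S.card) := by
      refine hgap.trans ?_
      exact_mod_cast Nat.mul_le_mul_left (N + 1) hchoose
    have := Real.log_le_log (by positivity) hle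
    rw [Real.log_pow, Real.log_mul (by positivity) (by positivity),
      Real.log_mul (by positivity) (by positivity), Real.log_mul (by positivity) (by positivity),
      Real.log_pow] at this
    linarith
  have e2 : D * Real.log q ≤ Real.log A' + K * (K * m) * Real.log 2 := by
    have hle : (q : ℝ) ^ D ≤ A' * 2 ^ (K * (K * m)) := by exact_mod_cast hD
    have hqpos : (0 : ℝ) < q := by exact_mod_cast hq.pos
    have := Real.log_le_log (by positivity) hle
    rw [Real.log_pow, Real.log_mul (by positivity) (by positivity), Real.log_pow] at this
    exact_mod_cast this
  have e3 : D * Real.log (4 * K) ≤ Real.log (4 * K) * Real.log A' / Real.log q + δ / 2 * N := by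
    have hmN : (m : ℝ) ≤ N := by
      have : m ≤ N := by rw [hN]; nlinarith
      exact_mod_cast this
    rw [div_le_iff₀ hδ0] at hlq
    have e4 : Real.log (4 * K) * (K * (K * m) * Real.log 2) ≤ δ / 2 * N * Real.log q := by
      have hm0 : (0 : ℝ) ≤ m := m.cast_nonneg
      calc Real.log (4 * K) * (K * (K * m) * Real.log 2)
          = (2 * Real.log (4 * K) * K ^ 2 * Real.log 2) * (m / 2) := by ring
        _ ≤ (Real.log q * δ) * (m / 2) := by gcongr
        _ ≤ (Real.log q * δ) * (N / 2) := by gcongr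
        _ = _ := by ring
    rw [← mul_le_mul_iff_left₀ hlq0, add_mul, div_mul_cancel₀ _ hlq0.ne']
    nlinarith [mul_le_mul_of_nonneg_left e2 hl4.le]
  rw [← Real.log_le_log_iff (by positivity) hS0', Real.log_rpow (by linarith)]
  have : (1 - ε) * N * Real.log c = N * Real.log c - δ * N := by rw [hδ]; ring
  rw [this]
  rw [hB] at hm2
  linarith

/-! ### The rate of growth -/

lemma growsAtLeast_of_eventually {u : ℕ → ℝ} {c : ℝ} (hc : 1 < c) (h1 : ∀ N, 1 ≤ u N)
    (h : ∀ ε : ℝ, 0 < ε → ε ≤ 1 → ∀ᶠ N : ℕ in Filter.atTop, c ^ ((1 - ε) * (N : ℝ)) ≤ u N) :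
    GrowsAtLeast u c := by
  -- The smallest nonnegative error that works for each `N`; `1 ≤ u N` keeps the logarithm
  -- meaningful for all `N`.
  refine ⟨fun N => max 0 ((N : ℝ) - Real.logb c (u N)), ?_, fun N => ?_⟩
  · rw [Asymptotics.isLittleO_iff]
    intro δ hδ
    filter_upwards [h (min δ 1) (by positivity) (min_le_right _ _)] with N hN
    rw [← Real.le_logb_iff_rpow_le hc (by linarith [h1 N])] at hN
    have hN0 : (0 : ℝ) ≤ N := N.cast_nonneg
    rw [Real.norm_of_nonneg (le_max_left _ _), Real.norm_of_nonneg hN0]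
    refine max_le (by positivity) ?_
    have := mul_le_mul_of_nonneg_right (min_le_left δ 1) hN0
    linarith
  · have hle : (N : ℝ) - max 0 ((N : ℝ) - Real.logb c (u N)) ≤ Real.logb c (u N) := by
      linarith [le_max_right 0 ((N : ℝ) - Real.logb c (u N))]
    calc c ^ ((N : ℝ) - max 0 ((N : ℝ) - Real.logb c (u N))) ≤ c ^ Real.logb c (u N) :=
          Real.rpow_le_rpow_of_exponent_le hc.le hle
      _ = u N := Real.rpow_logb (by linarith) hc.ne' (by linarith [h1 N])

theorem growsAtLeast_kronPow {K : Type*} [Field K] {k : ℕ} (hk : 2 ≤ k)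
    {f : (n : Fin k → ℕ) → KTensor K n → ℝ≥0} (hf : IsNormalizedMonotone f) {n : Fin k → ℕ}
    {T : KTensor K n} (hT : T ≠ 0) (hT1 : ¬ HasRankOneFlattening T) :
    GrowsAtLeast (fun N => (f (fun i => n i ^ N) (kronPow T N) : ℝ)) (gapConst k) := by
  have hc := one_lt_gapConst hk
  obtain ⟨M, hM⟩ := exists_diag_add hk hT hT1
  refine growsAtLeast_of_eventually hc (fun N => ?_) fun ε hε hε1 => ?_
  · exact_mod_cast one_le_kronPow (by omega) hf hT N
  · have ht : Filter.Tendsto (fun N : ℕ => (N - M) / k) Filter.atTop Filter.atTop :=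
      (Nat.tendsto_div_const_atTop (by omega)).comp (Filter.tendsto_sub_atTop_nat M)
    -- Half of `ε` is spent on the size of the puzzle, the other half on the at most `M + k` copies
    -- outside it.
    filter_upwards [ht.eventually (exists_isLocalUSP hk (half_pos hε)),
      Filter.eventually_ge_atTop (⌈2 * ((M : ℝ) + k) / ε⌉₊), Filter.eventually_ge_atTop M]
      with N hex hN hNM
    have hmod := Nat.div_add_mod (N - M) k
    have hlt := Nat.mod_lt (N - M) (show k > 0 by omega)
    set m := (N - M) / k
    obtain ⟨S, hS, hcard⟩ := hex
    have hdiag := hM m ((N - M) % k) S hS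
    rw [show k * m + (M + (N - M) % k) = N by omega] at hdiag
    have hle : (S.card : ℝ) ≤ f _ (kronPow T N) := by
      exact_mod_cast le_of_diag (by omega) hf hdiag
    refine le_trans (le_trans (Real.rpow_le_rpow_of_exponent_le hc.le ?_) hcard) hle
    have h1 : (N : ℝ) ≤ (k * m : ℕ) + (M + k) := by
      have : N ≤ k * m + (M + k) := by omega
      exact_mod_cast this
    have h2 : 2 * ((M : ℝ) + k) / ε ≤ N := Nat.ceil_le.1 hN
    rw [div_le_iff₀ hε] at h2
    nlinarith [mul_le_mul_of_nonneg_left h1 (show 0 ≤ 1 - ε / 2 by linarith),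
      mul_nonneg hε.le (show (0 : ℝ) ≤ (M : ℝ) + k by positivity)]

theorem kronPow_eq_one {K : Type*} [Field K] {k : ℕ} (hk : 2 ≤ k)
    {f : (n : Fin k → ℕ) → KTensor K n → ℝ≥0} (hf : IsNormalizedMonotone f)
    (hfb : BoundedByFlatteningRanks f) {n : Fin k → ℕ} {T : KTensor K n} (hT : T ≠ 0)
    (hT1 : HasRankOneFlattening T) (N : ℕ) : f (fun i => n i ^ N) (kronPow T N) = 1 := by
  obtain ⟨I, hI, h⟩ := hT1
  refine le_antisymm ?_ (one_le_kronPow (by omega) hf hT N)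
  simpa [rank_flattening_kronPow_eq_one hT h N] using hfb _ (kronPow T N) I hI

lemma not_growsAtLeast_one {c : ℝ} (hc : 1 < c) : ¬ GrowsAtLeast (fun _ => 1) c := by
  rintro ⟨e, he, h⟩
  have h2 := (Asymptotics.isLittleO_iff.1 he) (show (0 : ℝ) < 1 / 2 by norm_num)
  obtain ⟨N, hN, hN1⟩ := (h2.and (Filter.eventually_ge_atTop 1)).exists
  have h3 := h N
  have hN1' : (1 : ℝ) ≤ N := by exact_mod_cast hN1
  have h4 : (N : ℝ) - e N ≤ 0 := by
    by_contra! hpos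
    exact absurd h3 (not_le.2 (Real.one_lt_rpow hc hpos))
  rw [Real.norm_of_nonneg (by linarith : (0 : ℝ) ≤ N)] at hN
  have := le_trans (le_abs_self (e N)) hN
  linarith

end TensorGap

theorem mainTheorem7 {K : Type*} [Field K] (k : ℕ) (hk : 2 ≤ k)
    (f : (n : Fin k → ℕ) → TensorGap.KTensor K n → NNReal)
    (hf : TensorGap.IsNormalizedMonotone f) :
    (∀ (n : Fin k → ℕ) (T : TensorGap.KTensor K n), T ≠ 0 →
      ¬ TensorGap.HasRankOneFlattening T →
      TensorGap.GrowsAtLeast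
        (fun N => (f (fun i => n i ^ N) (TensorGap.kronPow T N) : ℝ)) (TensorGap.gapConst k)) ∧
    (TensorGap.BoundedByFlatteningRanks f →
      ∀ (n : Fin k → ℕ) (T : TensorGap.KTensor K n), T ≠ 0 →
        Xor
          (∀ N : ℕ, f (fun i => n i ^ N) (TensorGap.kronPow T N) = 1)
          (TensorGap.GrowsAtLeast
            (fun N => (f (fun i => n i ^ N) (TensorGap.kronPow T N) : ℝ))
            (TensorGap.gapConst k))) := by
  refine ⟨fun n T hT hT1 => TensorGap.growsAtLeast_kronPow hk hf hT hT1, fun hfb n T hT => ?_⟩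
  have hexcl : (∀ N : ℕ, f (fun i => n i ^ N) (TensorGap.kronPow T N) = 1) →
      ¬ TensorGap.GrowsAtLeast (fun N => (f (fun i => n i ^ N) (TensorGap.kronPow T N) : ℝ))
        (TensorGap.gapConst k) := by
    intro h
    simp only [h, NNReal.coe_one]
    exact TensorGap.not_growsAtLeast_one (TensorGap.one_lt_gapConst hk)
  by_cases hT1 : TensorGap.HasRankOneFlattening T
  · have h := TensorGap.kronPow_eq_one hk hf hfb hT hT1
    exact Or.inl ⟨h, hexcl h⟩
  · have h := TensorGap.growsAtLeast_kronPow hk hf hT hT1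
    exact Or.inr ⟨h, fun h' => hexcl h' h⟩
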